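/- **Setting.** Let $\mathcal X$ be a measurable space (for instance a Borel subset of $\mathbb R^d$), $\mathcal Y=\{-1,+1\}$, and let $\mathrm p^*$ be a probability distribution on $\mathcal X\times\mathcal Y$ with marginal $\mathrm p^*_x$ on $\mathcal X$. Let $\rho_{y}:\mathcal X\to[0,1]$, $y\in\mathcal Y$, be measurable, and let $\mathrm p^{\mathrm{tr}}$ be the law of the pair obtained by drawing $(x,y)$ from $\mathrm p^*$ and then flipping $y$ to $-y$ with probability $\rho_y(x)$. The training samples $(x_1,y_1),\dots,(x_n,y_n)$, $n\ge1$, are drawn independently from $\mathrm p^{\mathrm{tr}}$. Let $\mathcal H=\{\hbar_1,\dots,\hbar_T\}$ be a finite set of measurable functions $\mathcal X\to[-1,1]$ (base-rules) such that $-\hbar\in\mathcal H$ whenever $\hbar\in\mathcal H$; write $\boldsymbol\hbar(x)=(\hbar_1(x),\dots,\hbar_T(x))^\top$. Let $\mathcal D$ be the VC-dimension of $\mathcal H$ (for real-valued functions: the VC-dimension of their subgraphs, i.e. the pseudo-dimension), and suppose $n\ge\mathcal D$. Let $\lambda>0$ and $0<\delta<1$. **The learning problem.** Consider $$\min_{\mu\in\mathbb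 R^T}\ F(\mu)=\frac12-\frac1n\sum_{i=1}^n y_i\boldsymbol\hbar(x_i)^\top\mu+\lambda\|\mu\|_1\quad\text{s.t.}\quad-\tfrac12\le\boldsymbol\hbar(x)^\top\mu\le\tfrac12\ \ \forall x\in\mathcal X,\tag{dual}$$ and the minimax risk $\overline R=\inf_{\mathrm h}\sup_{\mathrm p\in\mathcal U}\mathbb E_{\mathrm p}\{1-\mathrm h(y|x)\}$, where $\mathrm h$ ranges over the (randomized, measurable) classification rules and $\mathcal U$ is the set of probability distributions $\mathrm p$ on $\mathcal X\times\mathcal Y$ with $\big|\mathbb E_{\mathrm p}\{y\hbar(x)\}-\frac1n\sum_{i}y_i\hbar(x_i)\big|\le\lambda$ for all $\hbar\in\mathcal H$. A vector $\mu$ is an $\varepsilon$-optimal solution of (dual) if $$\big(F(\mu)-\overline R\big)+\mathbb E_{\mathrm p^*_x}\Big(|\boldsymbol\hbar(x)^\top\mu|-\tfrac12\Big)_+\le\varepsilon .$$ **The algorithm.** For $\mathcal S\subseteq\mathcal H$, the sample linear program over $\mathcal S$ is $$\min_{\mu_+,\mu_-\succeq0}\ \frac12-\frac1n\sum_{i}y_iu_i^\top(\mu_+-\mu_-)+\lambda\mathbf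 1^\top(\mu_++\mu_-)\quad\text{s.t.}\quad-\tfrac12\le u_i^\top(\mu_+-\mu_-)\le\tfrac12,\ i=1,\dots,n,$$ with $u_i=(\hbar(x_i))_{\hbar\in\mathcal S}$, and its dual is $$\max_{\alpha,\beta\in\mathbb R^n,\ \alpha,\beta\succeq0}\ \tfrac12\big(1-\mathbf 1^\top(\alpha+\beta)\big)\quad\text{s.t.}\quad\Big|\sum_i\hbar(x_i)\big(\alpha_i-\beta_i-\tfrac{y_i}n\big)\Big|\le\lambda\ \ \forall\hbar\in\mathcal S .$$ Given $\alpha,\beta$, put $w_i=\big|\frac{y_i}n-(\alpha_i-\beta_i)\big|$ and $\widetilde y_i=\mathrm{sign}\big(\frac{y_i}n-(\alpha_i-\beta_i)\big)$. The algorithm starts with $\mathcal H^{(0)}=\emptyset$, $\mu^{(0)}=0$, $\alpha=\beta=0$ (so $w_i=1/n$, $\widetilde y_i=y_i$). In round $k$ the base learner returns some $\hbar\in\mathcal H$ (arbitrary, not necessarily the best one). If $\sum_iw_i\widetilde y_i\hbar(x_i)\le\lambda$, the algorithm stops, keeping the current coefficients ($\mu^{(k)}=\mu^{(k-1)}$)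 and dual solution. Otherwise $\hbar$ is added to $\mathcal H^{(k-1)}$; the sample linear program and its dual over the resulting set are solved; $\mu^{(k)}=\mu_+-\mu_-$ (with zero coefficients for the base-rules not in the set), and $\alpha,\beta$, $w_i$, $\widetilde y_i$ are updated with the dual solution; finally $\mathcal H^{(k)}$ is obtained by removing from the set all $\hbar$ with $\sum_iw_i\widetilde y_i\hbar(x_i)<\lambda$. **Theorem.** For each round $k$, with probability at least $1-\delta$ over the training samples the following holds for every run of the algorithm that reaches round $k$. If $\mu^*=\mu^*_+-\mu^*_-$ for a solution $(\mu^*_+,\mu^*_-)$ of the sample linear program over all the base-rules in $\mathcal H$, then $\mu^{(k)}$ is an $\varepsilon^{(k)}_{\mathrm{opt}}$-optimal solution of (dual) for some $$\varepsilon^{(k)}_{\mathrm{opt}}\le\Big(\max_{\hbar\in\mathcal H}\sum_{i=1}^nw_i\widetilde y_i\hbar(x_i)-\lambda\Big)_+\|\mu^*\|_1+\varepsilon(\delta),$$ where the weights $w_i$ and labels $\widetilde y_i$ are those given by the dual solution at round $k$, and $\varepsilon(\delta)=0$ if $\|\mu^{(k)}\|_1\le\frac12$, while for $\|\mu^{(k)}\|_1>\frac12$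 $$\varepsilon(\delta)=2\|\mu^{(k)}\|_1\sqrt{\frac{2\mathcal D\log(3n/\mathcal D)}n}+\Big(\|\mu^{(k)}\|_1-\frac12\Big)\sqrt{\frac{\log(1/\delta)}{2n}} .$$ -/

import Mathlib

open MeasureTheory

namespace RMBoost

noncomputable section

/-- The labels are `true` and `false`; their real values are `1` and `-1`. -/
def label (y : Bool) : ℝ := if y then 1 else -1

/-- The law of a training pair: draw `(x, y)` from `pstar`, then flip the label `y` with
probability `rho y x`. -/
def trainDist {X : Type*} [MeasurableSpace X] (pstar : Measure (X × Bool)) (rho : Bool → X → ℝ) :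
    Measure (X × Bool) :=
  pstar.withDensity (fun q => ENNReal.ofReal (1 - rho q.2 q.1)) +
    (pstar.withDensity (fun q => ENNReal.ofReal (rho q.2 q.1))).map (fun q => (q.1, !q.2))

/-- The 1-norm of a parameter vector. -/
def norm1 {T : ℕ} (mu : Fin T → ℝ) : ℝ := ∑ j, |mu j|

/-- The combination `hbar(x)ᵀ mu` of the base-rules `hbar 0, …, hbar (T - 1)`. -/
def comb {X : Type*} {T : ℕ} (hbar : Fin T → X → ℝ) (mu : Fin T → ℝ) (x : X) : ℝ :=
  ∑ j, hbar j x * mu j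

/-! ### The minimax problem -/

/-- Randomized classification rules: `h x y` is the probability of assigning label `y` to `x`. -/
def rules (X : Type*) [MeasurableSpace X] : Set (X → Bool → ℝ) :=
  {h | (∀ y, Measurable fun x => h x y) ∧ (∀ x y, 0 ≤ h x y) ∧ ∀ x, ∑ y, h x y = 1}

/-- Error probability (expected 0-1 loss) of the rule `h` under `p`. -/
def risk {X : Type*} [MeasurableSpace X] (p : Measure (X × Bool)) (h : X → Bool → ℝ) : ℝ :=
  ∫ q, (1 - h q.1 q.2) ∂p

/-- The uncertainty set given by the training samples `z`, the base-rules and `lam`. -/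
def uncertaintySet {X : Type*} [MeasurableSpace X] {n T : ℕ} (lam : ℝ) (hbar : Fin T → X → ℝ)
    (z : Fin n → X × Bool) : Set (Measure (X × Bool)) :=
  {p | IsProbabilityMeasure p ∧
    ∀ j, |(∫ q, label q.2 * hbar j q.1 ∂p) -
      (1 / (n : ℝ)) * ∑ i, label (z i).2 * hbar j (z i).1| ≤ lam}

/-- The minimax risk: the least worst-case error probability over the uncertainty set. -/
def minimaxRisk {X : Type*} [MeasurableSpace X] {n T : ℕ} (lam : ℝ) (hbar : Fin T → X → ℝ)
    (z : Fin n → X × Bool) : ℝ :=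
  sInf ((fun h => sSup ((fun p => risk p h) '' uncertaintySet lam hbar z)) '' rules X)

/-- The objective `F` of the learning problem `min F(mu)` subject to
`-1/2 ≤ hbar(x)ᵀ mu ≤ 1/2` for all `x`. -/
def objective {X : Type*} {n T : ℕ} (lam : ℝ) (hbar : Fin T → X → ℝ) (z : Fin n → X × Bool)
    (mu : Fin T → ℝ) : ℝ :=
  1 / 2 - (1 / (n : ℝ)) * ∑ i, label (z i).2 * comb hbar mu (z i).1 + lam * norm1 mu

/-- `mu` is an `eps`-optimal solution of the learning problem: value suboptimality (with respect
to the minimax risk) plus expected constraint violation is at most `eps`. -/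
def IsEpsOptimal {X : Type*} [MeasurableSpace X] {n T : ℕ} (lam : ℝ) (hbar : Fin T → X → ℝ)
    (z : Fin n → X × Bool) (pstar : Measure (X × Bool)) (mu : Fin T → ℝ) (eps : ℝ) : Prop :=
  (objective lam hbar z mu - minimaxRisk lam hbar z) +
    ∫ x, max (|comb hbar mu x| - 1 / 2) 0 ∂(pstar.map Prod.fst) ≤ eps

/-! ### The linear program on the samples, and its dual, for a set `S` of base-rules.
A vector indexed by `S` is a vector indexed by all base-rules that vanishes outside `S`. -/

def PrimalFeasible {X : Type*} {n T : ℕ} (hbar : Fin T → X → ℝ) (z : Fin n → X × Bool)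
    (S : Finset (Fin T)) (mup mum : Fin T → ℝ) : Prop :=
  (∀ j, 0 ≤ mup j) ∧ (∀ j, 0 ≤ mum j) ∧ (∀ j, j ∉ S → mup j = 0 ∧ mum j = 0) ∧
    ∀ i, -(1 / 2) ≤ comb hbar (mup - mum) (z i).1 ∧ comb hbar (mup - mum) (z i).1 ≤ 1 / 2

def primalValue {X : Type*} {n T : ℕ} (lam : ℝ) (hbar : Fin T → X → ℝ) (z : Fin n → X × Bool)
    (mup mum : Fin T → ℝ) : ℝ :=
  1 / 2 - (1 / (n : ℝ)) * ∑ i, label (z i).2 * comb hbar (mup - mum) (z i).1 +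
    lam * ∑ j, (mup j + mum j)

def IsPrimalSolution {X : Type*} {n T : ℕ} (lam : ℝ) (hbar : Fin T → X → ℝ)
    (z : Fin n → X × Bool) (S : Finset (Fin T)) (mup mum : Fin T → ℝ) : Prop :=
  PrimalFeasible hbar z S mup mum ∧
    ∀ mup' mum', PrimalFeasible hbar z S mup' mum' →
      primalValue lam hbar z mup mum ≤ primalValue lam hbar z mup' mum'

def DualFeasible {X : Type*} {n T : ℕ} (lam : ℝ) (hbar : Fin T → X → ℝ) (z : Fin n → X × Bool)
    (S : Finset (Fin T)) (alpha beta : Fin n → ℝ) : Prop :=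
  (∀ i, 0 ≤ alpha i) ∧ (∀ i, 0 ≤ beta i) ∧
    ∀ j ∈ S, |∑ i, hbar j (z i).1 * (alpha i - beta i - label (z i).2 / n)| ≤ lam

def dualValue {n : ℕ} (alpha beta : Fin n → ℝ) : ℝ :=
  (1 / 2) * (1 - ∑ i, (alpha i + beta i))

def IsDualSolution {X : Type*} {n T : ℕ} (lam : ℝ) (hbar : Fin T → X → ℝ)
    (z : Fin n → X × Bool) (S : Finset (Fin T)) (alpha beta : Fin n → ℝ) : Prop :=
  DualFeasible lam hbar z S alpha beta ∧
    ∀ alpha' beta', DualFeasible lam hbar z S alpha' beta' →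
      dualValue alpha' beta' ≤ dualValue alpha beta

/-! ### The learning algorithm -/

/-- The weight of sample `i` given by the dual variables. -/
def weight {X : Type*} {n : ℕ} (z : Fin n → X × Bool) (alpha beta : Fin n → ℝ) (i : Fin n) : ℝ :=
  |label (z i).2 / n - (alpha i - beta i)|

/-- The modified label of sample `i` given by the dual variables. -/
def modLabel {X : Type*} {n : ℕ} (z : Fin n → X × Bool) (alpha beta : Fin n → ℝ) (i : Fin n) : ℝ :=
  Real.sign (label (z i).2 / n - (alpha i - beta i))

/-- The weighted edge `∑ i, w i * ỹ i * hbar j (x i)` of the base-rule `j`. -/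
def edge {X : Type*} {n T : ℕ} (hbar : Fin T → X → ℝ) (z : Fin n → X × Bool)
    (alpha beta : Fin n → ℝ) (j : Fin T) : ℝ :=
  ∑ i, weight z alpha beta i * modLabel z alpha beta i * hbar j (z i).1

/-- What the algorithm holds after a round: the selected base-rules, the coefficients, the dual
variables (which determine weights and labels), the optimal value, and whether it has stopped. -/
structure State (n T : ℕ) where
  selected : Finset (Fin T)
  mu : Fin T → ℝ
  alpha : Fin n → ℝ
  beta : Fin n → ℝ
  value : ℝ
  stopped : Prop

/-- `Run lam hbar z k s`: on the training samples `z`, some run of the algorithm is in state `s`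
after `k` rounds. The base learner may return any base-rule `j`, and any solutions of the linear
program and of its dual may be used. -/
inductive Run {X : Type*} {n T : ℕ} (lam : ℝ) (hbar : Fin T → X → ℝ) (z : Fin n → X × Bool) :
    ℕ → State n T → Prop
  /-- At the start `alpha = beta = 0`, that is, weights `1 / n` and labels `y i`. -/
  | start : Run lam hbar z 0
      { selected := ∅, mu := 0, alpha := 0, beta := 0, value := 1 / 2, stopped := False }
  /-- The algorithm stops, and keeps its coefficients and dual variables, if the base-rule
  returned has edge at most `lam`. -/
  | halt {k : ℕ} {s : State n T} (j : Fin T) (hs : Run lam hbar z k s) (hrun : ¬ s.stopped)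
      (hj : edge hbar z s.alpha s.beta j ≤ lam) :
      Run lam hbar z (k + 1)
        { selected := s.selected, mu := s.mu, alpha := s.alpha, beta := s.beta,
          value := s.value, stopped := True }
  /-- Otherwise the base-rule is added, the linear program is solved, and the base-rules of edge
  below `lam` for the new weights and labels are removed. -/
  | step {k : ℕ} {s : State n T} (j : Fin T) (mup mum : Fin T → ℝ) (alpha beta : Fin n → ℝ)
      (hs : Run lam hbar z k s) (hrun : ¬ s.stopped)
      (hj : lam < edge hbar z s.alpha s.beta j)
      (hprimal : IsPrimalSolution lam hbar z (insert j s.selected) mup mum)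
      (hdual : IsDualSolution lam hbar z (insert j s.selected) alpha beta) :
      Run lam hbar z (k + 1)
        { selected := (insert j s.selected).filter fun i => lam ≤ edge hbar z alpha beta i,
          mu := mup - mum, alpha := alpha, beta := beta,
          value := primalValue lam hbar z mup mum, stopped := False }

/-! ### Complexity of the base-rules and the generalization term -/

/-- The finite set `S` is shattered by the base-rules, for some thresholds `r`. -/
def Shatters {X : Type*} {T : ℕ} (hbar : Fin T → X → ℝ) (S : Finset X) : Prop :=
  ∃ r : X → ℝ, ∀ A ⊆ S, ∃ j, ∀ x ∈ S, x ∈ A ↔ r x < hbar j x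

/-- The VC-dimension of the family of base-rules, for real-valued functions: the VC-dimension of
their subgraphs (pseudo-dimension). It is the usual VC-dimension if the values are `1` and `-1`. -/
def vcDim {X : Type*} {T : ℕ} (hbar : Fin T → X → ℝ) : ℕ :=
  sSup {m | ∃ S : Finset X, S.card = m ∧ Shatters hbar S}

/-- The supremum that defines `vcDim` is over a bounded set. -/
theorem bddAbove_vcDim {X : Type*} {T : ℕ} (hbar : Fin T → X → ℝ) :
    BddAbove {m | ∃ S : Finset X, S.card = m ∧ Shatters hbar S} := by
  refine ⟨T, ?_⟩
  rintro m ⟨S, rfl, r, hr⟩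
  have : Nonempty (Fin T) := ⟨(hr ∅ (Finset.empty_subset S)).choose⟩
  choose! f hf using hr
  have hinj : Set.InjOn f (S.powerset : Set (Finset X)) := by
    intro A hA B hB hAB
    have hA' : A ⊆ S := by simpa using hA
    have hB' : B ⊆ S := by simpa using hB
    ext x
    constructor
    · intro hx
      have h1 := (hf A hA' x (hA' hx)).1 hx
      rw [hAB] at h1
      exact (hf B hB' x (hA' hx)).2 h1
    · intro hx
      have h1 := (hf B hB' x (hB' hx)).1 hx
      rw [← hAB] at h1
      exact (hf A hA' x (hB' hx)).2 h1
  have h := Finset.card_le_card_of_injOn (t := Finset.univ) f (fun _ _ => Finset.mem_univ _) hinj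
  rw [Finset.card_powerset, Finset.card_univ, Fintype.card_fin] at h
  exact (Nat.lt_two_pow_self).le.trans h

/-- The term `ε(δ)` for `n` samples, VC-dimension `D` and a parameter of 1-norm `c`. -/
def epsDelta (n D : ℕ) (δ c : ℝ) : ℝ :=
  if c ≤ 1 / 2 then 0
  else 2 * c * Real.sqrt (2 * D * Real.log (3 * n / D) / n) +
    (c - 1 / 2) * Real.sqrt (Real.log (1 / δ) / (2 * n))

end

end RMBoost

/-!
The suboptimality and the constraint violation are bounded separately.

*Suboptimality.* This part holds for every sample. Strong duality for the linear program on the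
samples follows from the Hahn–Banach theorem (`exists_multipliers`), and gives
`F(μ⁽ᵏ⁾) ≤ ½ (1 - 𝟏ᵀ(α + β))` along every run (`Run.invariant`). Weak duality against `μ*`, where
the dual constraints are violated by at most `max edge - λ`, compares this dual value with the
optimal value of the full program (`dualValue_le_primalValue_add`). That optimal value is at most
the minimax risk: optimal multipliers of the full program define a distribution on the sample
instances that lies in the uncertainty set and is equally hard for all rules (`le_minimaxRisk`).

*Violation.* After division by `c = ‖μ‖₁`, the claim concerns `g = (|ħ(x)ᵀν| - t)₊` with
`‖ν‖₁ ≤ 1` and `t = 1 / (2 c)`: with `R = √(2 D log (3 n / D) / n)` and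
`s = √(log (1 / δ) / (2 n))`, the mean of `g` is at most `2 R + (1 - t) s` if `g` vanishes on the
samples. For one fixed `t` this is the classical chain of McDiarmid's inequality, symmetrization,
contraction, Massart's lemma and the Sauer–Shelah lemma. But `t` depends on the data, and the
claim has no loss for uniformity in `t`. So the expected maximal deviation has to be strictly
smaller than `2 R`. This is achieved by symmetrizing with `2 n` random signs, all independent,
instead of `n` (`integral_iSup_sub_le`): a sign vector and its opposite, with `n + d` and `n - d`
minus signs, together dominate `2 - d / n` times the deviation of `n` samples, since by Jensen's
inequality the points with a plus sign may be replaced by their mean, superfluous points may be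
dropped in the same way, and missing points may be added by averaging over subsets. The result is
about `√2 R`; if `2 R < 1` it is at most `0.797 · 2 R` (`symmetrization_bound_le`), and if `2 R ≥ 1`
there is nothing to prove. The gain `κ = 0.203 · 2 R` pays for applying McDiarmid's inequality at the
countably many margins `t = 1 - 1 / b`, `b = 1 + j κ / 8`, with failure probabilities that add up to
at most `δ`, and for passing from these margins to all others (`exists_uniform_margin_set`).
-/

namespace RMBoost

/-! ### Linear programming duality -/

/-- If `⟨e, μ⟩ - lam ‖μ‖₁ ≤ v` whenever `‖U μ‖_∞ ≤ 1/2`, then by homogeneity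
`⟨e, μ⟩ ≤ lam ‖μ‖₁ + 2 v ‖U μ‖_∞` for all `μ`. By Hahn–Banach the functional `⟨e, ·⟩` on the graph
of `U` extends to a functional on the whole product with the same bound, and the coordinates of
the extension are the multipliers `γ`. -/
theorem exists_multipliers {I J : Type*} [Fintype I] [Fintype J] (U : I → J → ℝ) (e : J → ℝ)
    {lam v : ℝ} (hlam : 0 ≤ lam)
    (h : ∀ μ : J → ℝ, (∀ i, |∑ j, U i j * μ j| ≤ 1 / 2) →
      ∑ j, e j * μ j - lam * ∑ j, |μ j| ≤ v) :
    ∃ γ : I → ℝ, (∀ j, |∑ i, U i j * γ i - e j| ≤ lam) ∧ ∑ i, |γ i| ≤ 2 * v := by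
  classical
  have hv : 0 ≤ v := by simpa using h 0 (by simp)
  let A : (J → ℝ) →ₗ[ℝ] (I → ℝ) := Matrix.toLin' (Matrix.of U)
  have hA : ∀ μ i, A μ i = ∑ j, U i j * μ j := fun μ i => by
    simp [A, Matrix.toLin'_apply, Matrix.mulVec, dotProduct]
  -- The bound for all `μ`, by scaling.
  have key : ∀ μ : J → ℝ, ∑ j, e j * μ j ≤ lam * ∑ j, |μ j| + 2 * v * ‖A μ‖ := by
    intro μ
    have hscale : ∀ t : ℝ, 0 ≤ t → t * ‖A μ‖ ≤ 1 / 2 →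
        t * (∑ j, e j * μ j - lam * ∑ j, |μ j|) ≤ v := by
      intro t ht htA
      have := h (t • μ) (fun i => by
        rw [← hA, map_smul]
        calc |(t • A μ) i| = t * |A μ i| := by simp [abs_mul, abs_of_nonneg ht]
          _ ≤ t * ‖A μ‖ := by gcongr; simpa using norm_le_pi_norm (A μ) i
          _ ≤ 1 / 2 := htA)
      calc _ = ∑ j, e j * (t • μ) j - lam * ∑ j, |(t • μ) j| := by
            simp only [Pi.smul_apply, smul_eq_mul, abs_mul, abs_of_nonneg ht, mul_sub,
              Finset.mul_sum]
            congr 1 <;> exact Finset.sum_congr rfl fun _ _ => by ring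
        _ ≤ v := this
    rcases (norm_nonneg (A μ)).eq_or_lt with h0 | h0
    · rw [← h0] at hscale ⊢
      by_contra! hc
      have hpos : 0 < ∑ j, e j * μ j - lam * ∑ j, |μ j| := by linarith
      have h1 := hscale ((v + 1) / (∑ j, e j * μ j - lam * ∑ j, |μ j|)) (by positivity) (by simp)
      rw [div_mul_cancel₀ _ hpos.ne'] at h1
      linarith
    · have h1 := hscale (1 / (2 * ‖A μ‖)) (by positivity) (by field_simp; rfl)
      rw [one_div, inv_mul_le_iff₀ (by positivity)] at h1
      linarith
  let f : ((J → ℝ) × (I → ℝ)) →ₗ.[ℝ] ℝ :=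
    { domain := A.graph
      toFun := (Fintype.linearCombination ℝ e ∘ₗ LinearMap.fst ℝ _ _) ∘ₗ A.graph.subtype }
  let N : ((J → ℝ) × (I → ℝ)) → ℝ := fun p => lam * ∑ j, |p.1 j| + 2 * v * ‖p.2‖
  have hf : ∀ x : f.domain, f x = ∑ j, e j * x.1.1 j := fun x => by
    change Fintype.linearCombination ℝ e x.1.1 = _
    simp [Fintype.linearCombination_apply, mul_comm]
  obtain ⟨g, hg, hgN⟩ := exists_extension_of_le_sublinear f N
    (fun c hc x => by
      simp only [N, Prod.smul_fst, Prod.smul_snd, norm_smul, Pi.smul_apply, smul_eq_mul, abs_mul,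
        abs_of_pos hc, Real.norm_eq_abs, ← Finset.mul_sum]
      ring)
    (fun x y => by
      have h1 : ∑ j, |(x + y).1 j| ≤ ∑ j, |x.1 j| + ∑ j, |y.1 j| := by
        rw [← Finset.sum_add_distrib]
        exact Finset.sum_le_sum fun j _ => abs_add_le _ _
      have h2 : ‖(x + y).2‖ ≤ ‖x.2‖ + ‖y.2‖ := norm_add_le _ _
      simp only [N]
      nlinarith [mul_le_mul_of_nonneg_left h1 hlam, mul_le_mul_of_nonneg_left h2 hv])
    (fun x => by
      rw [hf]
      have hx : x.1.2 = A x.1.1 := x.2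
      simpa only [N, hx] using key x.1.1)
  refine ⟨fun i => g (0, Pi.single i 1), fun j => ?_, ?_⟩
  · have hexp : g (Pi.single j 1, A (Pi.single j 1)) =
        g (Pi.single j 1, 0) + ∑ i, U i j * g (0, Pi.single i 1) := by
      have : ((Pi.single j 1, A (Pi.single j 1)) : (J → ℝ) × (I → ℝ)) =
          (Pi.single j 1, 0) + ∑ i, U i j • ((0, Pi.single i 1) : (J → ℝ) × (I → ℝ)) := by
        ext k
        · simp [Prod.fst_sum]
        · simp [Prod.snd_sum, hA, Finset.sum_apply, Pi.single_apply]
      rw [this, map_add, map_sum]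
      simp only [map_smul, smul_eq_mul]
    have hgr : g (Pi.single j 1, A (Pi.single j 1)) = e j := by
      have := hg ⟨(Pi.single j 1, A (Pi.single j 1)), rfl⟩
      rw [hf] at this
      simpa [Pi.single_apply] using this
    have hsum : ∑ k : J, |(Pi.single j (1 : ℝ) : J → ℝ) k| = 1 := by
      rw [Finset.sum_eq_single j] <;> simp +contextual
    have h1 : g (Pi.single j 1, 0) ≤ lam := by
      simpa [N, hsum] using hgN (Pi.single j 1, 0)
    have h2 : -g (Pi.single j 1, 0) ≤ lam := by
      have := hgN (-(Pi.single j 1, 0))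
      rw [map_neg] at this
      simpa [N, hsum] using this
    rw [abs_le]
    constructor <;> linarith
  · have h1 : ∑ i, |g (0, Pi.single i 1)| =
        g (0, fun i => (SignType.sign (g (0, Pi.single i 1)) : ℝ)) := by
      have : ((0, fun i => (SignType.sign (g (0, Pi.single i 1)) : ℝ)) : (J → ℝ) × (I → ℝ)) =
          ∑ i, (SignType.sign (g (0, Pi.single i 1)) : ℝ) •
            ((0, Pi.single i 1) : (J → ℝ) × (I → ℝ)) := by
        ext k
        · simp [Prod.fst_sum]
        · simp [Prod.snd_sum, Finset.sum_apply, Pi.single_apply]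
      rw [this, map_sum]
      exact Finset.sum_congr rfl fun i _ => by
        rw [map_smul, smul_eq_mul, sign_mul_self]
    have h2 : ‖(fun i => (SignType.sign (g (0, Pi.single i 1)) : ℝ))‖ ≤ 1 := by
      refine (pi_norm_le_iff_of_nonneg zero_le_one).2 fun i => ?_
      cases SignType.sign (g (0, Pi.single i 1)) <;> simp
    rw [h1]
    refine (hgN _).trans ?_
    simp only [N, Pi.zero_apply, abs_zero, Finset.sum_const_zero, mul_zero, zero_add]
    nlinarith

/-! ### The linear programs -/

section LinearProgram

variable {X : Type*} {n T : ℕ} {lam : ℝ} {hbar : Fin T → X → ℝ} {z : Fin n → X × Bool}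

/-- Strong duality for the linear program on the samples. The multipliers `γ` stand for
`alpha - beta`. -/
theorem IsPrimalSolution.exists_multipliers (hlam : 0 ≤ lam) {S : Finset (Fin T)}
    {mup mum : Fin T → ℝ} (h : IsPrimalSolution lam hbar z S mup mum) :
    ∃ γ : Fin n → ℝ,
      (∀ j ∈ S, |∑ i, hbar j (z i).1 * (γ i - label (z i).2 / n)| ≤ lam) ∧
      primalValue lam hbar z mup mum ≤ (1 / 2) * (1 - ∑ i, |γ i|) := by
  classical
  obtain ⟨γ, hγ1, hγ2⟩ := RMBoost.exists_multipliers (lam := lam)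
    (v := 1 / 2 - primalValue lam hbar z mup mum)
    (fun (i : Fin n) (j : S) => hbar j (z i).1)
    (fun j => ∑ i, hbar j (z i).1 * (label (z i).2 / n)) hlam (fun μ hμ => by
      -- `μ`, extended by zero, splits into its positive and negative parts
      let ν : Fin T → ℝ := fun j => if hj : j ∈ S then μ ⟨j, hj⟩ else 0
      have hν : ∀ F : Fin T → ℝ → ℝ, (∀ j, F j 0 = 0) → ∑ j, F j (ν j) = ∑ j : S, F j (μ j) := by
        intro F hF
        rw [← Finset.sum_subset (Finset.subset_univ S), ← Finset.sum_coe_sort]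
        · exact Finset.sum_congr rfl fun j _ => by simp [ν]
        · intro j _ hj
          simp [ν, hj, hF]
      have hsub : (fun j => max (ν j) 0) - (fun j => max (-ν j) 0) = ν := by
        ext j
        simp only [Pi.sub_apply]
        rcases le_total (ν j) 0 with h0 | h0
        · rw [max_eq_right h0, max_eq_left (by linarith)]; ring
        · rw [max_eq_left h0, max_eq_right (by linarith)]; ring
      have hcomb : ∀ i, comb hbar ν (z i).1 = ∑ j : S, hbar j (z i).1 * μ j := fun i =>
        hν (fun j t => hbar j (z i).1 * t) (by simp)
      have h1 := h.2 (fun j => max (ν j) 0) (fun j => max (-ν j) 0)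
        ⟨fun j => le_max_right _ _, fun j => le_max_right _ _, fun j hj => by simp [ν, hj],
          fun i => by
            rw [hsub, hcomb]
            exact abs_le.1 (hμ i)⟩
      have h2 : ∑ j, (max (ν j) 0 + max (-ν j) 0) = ∑ j : S, |μ j| := by
        rw [← hν (fun _ t => |t|) (by simp)]
        refine Finset.sum_congr rfl fun j _ => ?_
        rcases le_total (ν j) 0 with h0 | h0
        · rw [max_eq_right h0, max_eq_left (by linarith), abs_of_nonpos h0]; ring
        · rw [max_eq_left h0, max_eq_right (by linarith), abs_of_nonneg h0]; ring
      have h3 : (1 / (n : ℝ)) * ∑ i, label (z i).2 * comb hbar ν (z i).1 =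
          ∑ j : S, (∑ i, hbar j (z i).1 * (label (z i).2 / n)) * μ j := by
        simp only [hcomb, Finset.mul_sum, Finset.sum_mul]
        rw [Finset.sum_comm]
        exact Finset.sum_congr rfl fun j _ => Finset.sum_congr rfl fun i _ => by ring
      have h4 : primalValue lam hbar z (fun j => max (ν j) 0) (fun j => max (-ν j) 0) =
          1 / 2 - ∑ j : S, (∑ i, hbar j (z i).1 * (label (z i).2 / n)) * μ j
            + lam * ∑ j : S, |μ j| := by
        rw [primalValue, hsub, h2, h3]
      linarith)
  refine ⟨γ, fun j hj => ?_, by linarith⟩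
  have := hγ1 ⟨j, hj⟩
  simpa only [mul_sub, Finset.sum_sub_distrib] using this

theorem norm1_nonneg (mu : Fin T → ℝ) : 0 ≤ norm1 mu := Finset.sum_nonneg fun _ _ => abs_nonneg _

theorem norm1_sub_le (mup mum : Fin T → ℝ) (hp : ∀ j, 0 ≤ mup j) (hm : ∀ j, 0 ≤ mum j) :
    norm1 (mup - mum) ≤ ∑ j, (mup j + mum j) :=
  Finset.sum_le_sum fun j _ => by
    rw [Pi.sub_apply, abs_le]
    constructor <;> linarith [hp j, hm j]

/-- What every run preserves: the coefficients satisfy the constraints on the samples, and their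
objective is at most the value of the current dual variables, which are nonnegative. -/
theorem Run.invariant (hlam : 0 ≤ lam) {k : ℕ} {s : State n T} (h : Run lam hbar z k s) :
    (∀ i, |comb hbar s.mu (z i).1| ≤ 1 / 2) ∧ (∀ i, 0 ≤ s.alpha i) ∧ (∀ i, 0 ≤ s.beta i) ∧
      objective lam hbar z s.mu ≤ dualValue s.alpha s.beta := by
  induction h with
  | start => simp [comb, objective, dualValue, norm1]
  | halt j _ _ _ ih => exact ih
  | step j mup mum alpha beta _ _ _ hprimal hdual ih =>
    refine ⟨fun i => abs_le.2 (hprimal.1.2.2.2 i), hdual.1.1, hdual.1.2.1, ?_⟩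
    obtain ⟨γ, hγ1, hγ2⟩ := hprimal.exists_multipliers hlam
    have hpm : ∀ t : ℝ, max t 0 - max (-t) 0 = t ∧ max t 0 + max (-t) 0 = |t| := fun t => by
      rcases le_total t 0 with h0 | h0
      · rw [max_eq_right h0, max_eq_left (by linarith), abs_of_nonpos h0]; simp
      · rw [max_eq_left h0, max_eq_right (by linarith), abs_of_nonneg h0]; simp
    have h1 := hdual.2 (fun i => max (γ i) 0) (fun i => max (-γ i) 0)
      ⟨fun _ => le_max_right _ _, fun _ => le_max_right _ _, fun j hj => by
        simpa only [hpm] using hγ1 j hj⟩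
    simp only [dualValue, hpm] at h1 ⊢
    refine le_trans ?_ (hγ2.trans h1)
    have := norm1_sub_le mup mum hprimal.1.1 hprimal.1.2.1
    simp only [objective, primalValue]
    nlinarith

/-- Weak duality with the constraint for the base-rules violated by `max edge - lam`. -/
theorem dualValue_le_primalValue_add (hneg : ∀ j, ∃ j', ∀ x, hbar j' x = -hbar j x)
    (hlam : 0 ≤ lam) {alpha beta : Fin n → ℝ} (ha : ∀ i, 0 ≤ alpha i) (hb : ∀ i, 0 ≤ beta i)
    {S : Finset (Fin T)} {mup mum : Fin T → ℝ} (h : PrimalFeasible hbar z S mup mum) :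
    dualValue alpha beta ≤ primalValue lam hbar z mup mum +
      max ((⨆ j, edge hbar z alpha beta j) - lam) 0 * norm1 (mup - mum) := by
  set μ := mup - mum with hμ
  set E := ⨆ j, edge hbar z alpha beta j
  have hedge : ∀ j, edge hbar z alpha beta j =
      ∑ i, (label (z i).2 / n - (alpha i - beta i)) * hbar j (z i).1 := fun j => by
    refine Finset.sum_congr rfl fun i _ => ?_
    rw [weight, modLabel]
    congr 1
    rcases lt_trichotomy (label (z i).2 / n - (alpha i - beta i)) 0 with h0 | h0 | h0
    · rw [Real.sign_of_neg h0, abs_of_neg h0]; ring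
    · simp [h0]
    · rw [Real.sign_of_pos h0, abs_of_pos h0]; ring
  have hE : ∀ j, |edge hbar z alpha beta j| ≤ E := fun j => by
    have hle : ∀ j, edge hbar z alpha beta j ≤ E :=
      fun j => le_ciSup (Set.finite_range _).bddAbove j
    obtain ⟨j', hj'⟩ := hneg j
    have : edge hbar z alpha beta j' = -edge hbar z alpha beta j := by
      simp [hedge, hj']
    rw [abs_le]
    constructor <;> linarith [hle j, hle j']
  have h1 : ∑ i, (label (z i).2 / n - (alpha i - beta i)) * comb hbar μ (z i).1 ≤
      E * norm1 μ := by
    calc _ = ∑ j, edge hbar z alpha beta j * μ j := by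
          simp only [hedge, comb, Finset.mul_sum, Finset.sum_mul]
          rw [Finset.sum_comm]
          exact Finset.sum_congr rfl fun j _ => Finset.sum_congr rfl fun i _ => by ring
      _ ≤ ∑ j, E * |μ j| := Finset.sum_le_sum fun j _ => by
          refine (le_abs_self _).trans ?_
          rw [abs_mul]
          exact mul_le_mul_of_nonneg_right (hE j) (abs_nonneg _)
      _ = _ := by rw [norm1, Finset.mul_sum]
  have h2 : ∑ i, (alpha i - beta i) * comb hbar μ (z i).1 ≤
      (1 / 2) * ∑ i, (alpha i + beta i) := by
    rw [Finset.mul_sum]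
    refine Finset.sum_le_sum fun i _ => ?_
    have := h.2.2.2 i
    nlinarith [ha i, hb i]
  have h3 : (1 / (n : ℝ)) * ∑ i, label (z i).2 * comb hbar μ (z i).1 =
      ∑ i, (label (z i).2 / n - (alpha i - beta i)) * comb hbar μ (z i).1 +
        ∑ i, (alpha i - beta i) * comb hbar μ (z i).1 := by
    rw [← Finset.sum_add_distrib, Finset.mul_sum]
    exact Finset.sum_congr rfl fun i _ => by ring
  have h4 := norm1_sub_le mup mum h.1 h.2.1
  have h5 : (E - lam) * norm1 μ ≤ max (E - lam) 0 * norm1 μ :=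
    mul_le_mul_of_nonneg_right (le_max_left _ _) (norm1_nonneg _)
  simp only [dualValue, primalValue, ← hμ, h3]
  nlinarith [mul_le_mul_of_nonneg_left h4 hlam]

end LinearProgram

/-! ### The minimax risk -/

section MinimaxRisk

variable {X : Type*} [MeasurableSpace X] {n T : ℕ} {lam : ℝ} {hbar : Fin T → X → ℝ}
  {z : Fin n → X × Bool}

/-- The distribution with mass `w (i, y)` at the sample instance `i` with label `y`. -/
noncomputable def sampleMeasure (z : Fin n → X × Bool) (w : Fin n × Bool → ℝ) : Measure (X × Bool) :=
  ∑ a, ENNReal.ofReal (w a) • Measure.dirac ((z a.1).1, a.2)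

theorem integral_sampleMeasure {w : Fin n × Bool → ℝ} (hw : ∀ a, 0 ≤ w a) {f : X × Bool → ℝ}
    (hf : Measurable f) :
    ∫ q, f q ∂(sampleMeasure z w) = ∑ a, w a * f ((z a.1).1, a.2) := by
  have hint : ∀ q, Integrable f (Measure.dirac q) := fun q =>
    integrable_dirac' hf.stronglyMeasurable (by simp)
  rw [sampleMeasure, integral_finsetSum_measure
    fun a _ => (hint _).smul_measure ENNReal.ofReal_ne_top]
  refine Finset.sum_congr rfl fun a _ => ?_
  rw [integral_smul_measure, integral_dirac' _ _ hf.stronglyMeasurable,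
    ENNReal.toReal_ofReal (hw a), smul_eq_mul]

/-- Given multipliers `γ` with `∑ |γ i| ≤ 1`, the distribution with masses
`(|γ i| ± γ i) / 2 + (1 - ∑ |γ i|) / (2 n)` at `(x i, ± 1)` lies in the uncertainty set, and every
rule has error probability at least `(1 - ∑ |γ i|) / 2` there. -/
theorem le_minimaxRisk (hn : 0 < n) (hmeas : ∀ j, Measurable (hbar j)) {γ : Fin n → ℝ}
    (hγ : ∀ j, |∑ i, hbar j (z i).1 * (γ i - label (z i).2 / n)| ≤ lam)
    (hγ1 : ∑ i, |γ i| ≤ 1) :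
    (1 / 2) * (1 - ∑ i, |γ i|) ≤ minimaxRisk lam hbar z := by
  have hn0 : (n : ℝ) ≠ 0 := by positivity
  set W := ∑ i, |γ i| with hW
  let w : Fin n × Bool → ℝ := fun a => (|γ a.1| + label a.2 * γ a.1) / 2 + (1 - W) / (2 * n)
  have hw1 : ∀ a, (1 - W) / (2 * n) ≤ w a := fun a => by
    have : 0 ≤ |γ a.1| + label a.2 * γ a.1 := by
      cases a.2 <;> simp only [label, if_true, if_false, Bool.false_eq_true] <;>
        linarith [neg_abs_le (γ a.1), le_abs_self (γ a.1)]
    simp only [w]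
    linarith
  have hc : 0 ≤ (1 - W) / (2 * n) := div_nonneg (by linarith) (by positivity)
  have hw0 : ∀ a, 0 ≤ w a := fun a => hc.trans (hw1 a)
  have hsumc : ∑ _i : Fin n, (1 - W) / (2 * n) = (1 - W) / 2 := by
    rw [Finset.sum_const, Finset.card_univ, Fintype.card_fin, nsmul_eq_mul]
    field_simp
  have hprob : IsProbabilityMeasure (sampleMeasure z w) := by
    refine ⟨?_⟩
    have h1 : ∑ a, w a = 1 := by
      simp only [Fintype.sum_prod_type, Fintype.sum_bool, w, label, if_true, if_false,
        Bool.false_eq_true]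
      have : ∀ i, (|γ i| + 1 * γ i) / 2 + (1 - W) / (2 * n) + ((|γ i| + -1 * γ i) / 2 +
          (1 - W) / (2 * n)) = |γ i| + 2 * ((1 - W) / (2 * n)) := fun i => by ring
      simp only [this, Finset.sum_add_distrib, ← Finset.mul_sum, hsumc]
      rw [← hW]
      ring
    simp only [sampleMeasure, Measure.finsetSum_apply, Measure.smul_apply, measure_univ,
      smul_eq_mul, mul_one]
    rw [← ENNReal.ofReal_sum_of_nonneg fun a _ => hw0 a, h1, ENNReal.ofReal_one]
  have hmem : sampleMeasure z w ∈ uncertaintySet lam hbar z := by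
    refine ⟨hprob, fun j => ?_⟩
    have hlab : Measurable fun q : X × Bool => label q.2 * hbar j q.1 :=
      ((measurable_of_finite label).comp measurable_snd).mul ((hmeas j).comp measurable_fst)
    rw [integral_sampleMeasure hw0 hlab]
    convert hγ j using 2
    rw [Finset.mul_sum, Fintype.sum_prod_type, ← Finset.sum_sub_distrib]
    refine Finset.sum_congr rfl fun i _ => ?_
    simp only [Fintype.sum_bool, w, label, if_true, if_false, Bool.false_eq_true]
    ring
  refine le_csInf ?_ ?_
  · refine Set.Nonempty.image _ ⟨fun _ _ => 1 / 2, ?_⟩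
    simp only [rules, Set.mem_ofPred_eq, Fintype.sum_bool]
    exact ⟨fun _ => measurable_const, fun _ _ => by norm_num, fun _ => by norm_num⟩
  · rintro _ ⟨h, ⟨hm, h0, h1⟩, rfl⟩
    have hle1 : ∀ x y, h x y ≤ 1 := fun x y => by
      rw [← h1 x]
      exact Finset.single_le_sum (fun y _ => h0 x y) (Finset.mem_univ y)
    have hmeas' : Measurable fun q : X × Bool => 1 - h q.1 q.2 :=
      measurable_const.sub (measurable_from_prod_countable_left hm)
    refine le_trans ?_ (le_csSup ?_ ⟨_, hmem, rfl⟩)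
    · simp only [risk]
      rw [integral_sampleMeasure hw0 hmeas', Fintype.sum_prod_type]
      calc (1 / 2) * (1 - W) = ∑ _i : Fin n, (1 - W) / (2 * n) := by rw [hsumc]; ring
        _ ≤ _ := Finset.sum_le_sum fun i _ => by
          have h2 := h1 (z i).1
          rw [Fintype.sum_bool] at h2 ⊢
          nlinarith [hw1 (i, true), hw1 (i, false), hle1 (z i).1 true, hle1 (z i).1 false]
    · refine ⟨1, ?_⟩
      rintro _ ⟨p, ⟨hp, -⟩, rfl⟩
      have : ‖risk p h‖ ≤ 1 * p.real Set.univ :=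
        norm_integral_le_of_norm_le_const (Filter.Eventually.of_forall fun q => by
          rw [Real.norm_eq_abs, abs_le]
          constructor <;> linarith [h0 q.1 q.2, hle1 q.1 q.2])
      rw [probReal_univ, mul_one] at this
      exact (le_abs_self _).trans this

theorem IsPrimalSolution.primalValue_le_minimaxRisk (hn : 0 < n)
    (hmeas : ∀ j, Measurable (hbar j)) (hlam : 0 ≤ lam) {mup mum : Fin T → ℝ}
    (h : IsPrimalSolution lam hbar z Finset.univ mup mum) :
    primalValue lam hbar z mup mum ≤ minimaxRisk lam hbar z := by
  obtain ⟨γ, hγ1, hγ2⟩ := h.exists_multipliers hlam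
  refine hγ2.trans (le_minimaxRisk hn hmeas (fun j => hγ1 j (Finset.mem_univ j)) ?_)
  suffices 0 ≤ primalValue lam hbar z mup mum by linarith
  have h1 : (1 / (n : ℝ)) * ∑ i, label (z i).2 * comb hbar (mup - mum) (z i).1 ≤ 1 / 2 := by
    have : ∑ i, label (z i).2 * comb hbar (mup - mum) (z i).1 ≤ ∑ _i : Fin n, (1 / 2 : ℝ) :=
      Finset.sum_le_sum fun i _ => by
        have := h.1.2.2.2 i
        cases (z i).2 <;> simp only [label, if_true, if_false, Bool.false_eq_true] <;> linarith
    rw [Finset.sum_const, Finset.card_univ, Fintype.card_fin, nsmul_eq_mul] at this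
    rw [one_div, inv_mul_le_iff₀ (by positivity)]
    exact this
  have h2 : 0 ≤ lam * ∑ j, (mup j + mum j) :=
    mul_nonneg hlam (Finset.sum_nonneg fun j _ => add_nonneg (h.1.1 j) (h.1.2.1 j))
  rw [primalValue]
  linarith

/-- The suboptimality of the coefficients held by a run. -/
theorem Run.objective_sub_minimaxRisk_le (hn : 0 < n) (hmeas : ∀ j, Measurable (hbar j))
    (hneg : ∀ j, ∃ j', ∀ x, hbar j' x = -hbar j x) (hlam : 0 ≤ lam) {k : ℕ} {s : State n T}
    (hs : Run lam hbar z k s) {mup mum : Fin T → ℝ}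
    (h : IsPrimalSolution lam hbar z Finset.univ mup mum) :
    objective lam hbar z s.mu - minimaxRisk lam hbar z ≤
      max ((⨆ j, edge hbar z s.alpha s.beta j) - lam) 0 * norm1 (mup - mum) := by
  obtain ⟨-, ha, hb, hobj⟩ := hs.invariant hlam
  have h1 := dualValue_le_primalValue_add hneg hlam ha hb h.1
  have h2 := h.primalValue_le_minimaxRisk hn hmeas hlam
  linarith

end MinimaxRisk

/-! ### The bounded differences inequality -/

section BoundedDifferences

variable {Ω : Type*} [MeasurableSpace Ω]

theorem integrable_of_abs_le {μ : Measure Ω} [IsFiniteMeasure μ] {f : Ω → ℝ} (hf : Measurable f)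
    {C : ℝ} (h : ∀ x, |f x| ≤ C) : Integrable f μ :=
  Integrable.of_bound hf.aestronglyMeasurable C (Filter.Eventually.of_forall h)

/-- Hoeffding's lemma for a function of oscillation at most `c`. -/
theorem integral_exp_le_of_oscillation (P : Measure Ω) [IsProbabilityMeasure P] {f : Ω → ℝ}
    (hf : Measurable f) {c : ℝ} (hc : ∀ x y, f x - f y ≤ c) (t : ℝ) :
    ∫ x, Real.exp (t * (f x - ∫ y, f y ∂P)) ∂P ≤ Real.exp (c ^ 2 * t ^ 2 / 8) := by
  have : Nonempty Ω := P.nonempty_of_neZero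
  obtain ⟨x0⟩ := this
  have hbdd : BddBelow (Set.range f) := ⟨f x0 - c, by
    rintro _ ⟨y, rfl⟩
    linarith [hc x0 y]⟩
  have : Nonempty Ω := ⟨x0⟩
  have hmem : ∀ x, f x ∈ Set.Icc (⨅ y, f y) ((⨅ y, f y) + c) := fun x =>
    ⟨ciInf_le hbdd x, by
      have : f x - c ≤ ⨅ y, f y := le_ciInf fun y => by linarith [hc x y]
      linarith⟩
  have h := (ProbabilityTheory.hasSubgaussianMGF_of_mem_Icc (μ := P) hf.aemeasurable
    (Filter.Eventually.of_forall hmem)).mgf_le t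
  rw [ProbabilityTheory.mgf] at h
  refine h.trans (le_of_eq ?_)
  congr 1
  push_cast
  rw [add_sub_cancel_left, Real.norm_eq_abs, div_pow, sq_abs]
  ring

theorem integral_exp_le_of_boundedDifferences (P : Measure Ω) [IsProbabilityMeasure P] {c : ℝ}
    (t : ℝ) : ∀ (n : ℕ) (f : (Fin n → Ω) → ℝ), Measurable f → (∃ C, ∀ z, |f z| ≤ C) →
      (∀ z i x, f (Function.update z i x) - f z ≤ c) →
      ∫ z, Real.exp (t * (f z - ∫ y, f y ∂(Measure.pi fun _ => P))) ∂(Measure.pi fun _ => P) ≤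
        Real.exp (n * (c ^ 2 * t ^ 2 / 8)) := by
  intro n
  induction n with
  | zero =>
    intro f _ _ _
    have : ∀ z, f z = f default := fun z => congrArg f (Subsingleton.elim _ _)
    simp [this]
  | succ n ih =>
    rintro f hf ⟨C, hC⟩ hc
    let e := MeasurableEquiv.piFinSuccAbove (fun _ : Fin (n + 1) => Ω) 0
    have he : MeasurePreserving e (Measure.pi fun _ => P) (P.prod (Measure.pi fun _ => P)) :=
      measurePreserving_piFinSuccAbove (fun _ : Fin (n + 1) => P) 0
    have hsymm : ∀ q : Ω × (Fin n → Ω), e.symm q = Fin.cons q.1 q.2 := fun q => by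
      simp [e, MeasurableEquiv.piFinSuccAbove, Fin.insertNthEquiv]
    have htr : ∀ φ : (Fin (n + 1) → Ω) → ℝ, ∫ z, φ z ∂(Measure.pi fun _ => P) =
        ∫ q, φ (e.symm q) ∂(P.prod (Measure.pi fun _ : Fin n => P)) := fun φ => by
      rw [← he.symm.integral_comp']
    let F : Ω × (Fin n → Ω) → ℝ := fun q => f (e.symm q)
    have hF : Measurable F := hf.comp e.symm.measurable
    have hFC : ∀ q, |F q| ≤ C := fun q => hC _
    let G : (Fin n → Ω) → ℝ := fun y => ∫ x, F (x, y) ∂P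
    have hG : Measurable G := by
      have : StronglyMeasurable G := hF.stronglyMeasurable.integral_prod_left'
      exact this.measurable
    have hGC : ∀ y, |G y| ≤ C := fun y => by
      have := norm_integral_le_of_norm_le_const (μ := P) (f := fun x => F (x, y))
        (Filter.Eventually.of_forall fun x => hFC (x, y))
      simpa using this
    have hsec : ∀ y, Measurable fun x => F (x, y) := fun y => hF.comp measurable_prodMk_right
    have hGF : ∀ y y', (∀ x, F (x, y) - F (x, y') ≤ c) → G y - G y' ≤ c := fun y y' h => by
      have hi : ∀ y, Integrable (fun x => F (x, y)) P := fun y =>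
        integrable_of_abs_le (hsec y) fun x => hFC (x, y)
      rw [← integral_sub (hi y) (hi y')]
      calc _ ≤ ∫ _x, c ∂P := integral_mono ((hi y).sub (hi y')) (integrable_const c) h
        _ = c := by simp
    have hmean : ∫ z, f z ∂(Measure.pi fun _ => P) = ∫ y, G y ∂(Measure.pi fun _ => P) := by
      rw [htr, integral_prod_symm _ (integrable_of_abs_le hF hFC)]
    have hexp : ∀ {Ω' : Type _} (u : Ω' → ℝ) (m : ℝ), (∀ q, |u q| ≤ C) →
        ∀ q, |Real.exp (t * (u q - m))| ≤ Real.exp (|t| * (C + |m|)) := fun u m hu q => by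
      rw [Real.abs_exp]
      refine Real.exp_le_exp.2 ((le_abs_self _).trans ?_)
      rw [abs_mul]
      exact mul_le_mul_of_nonneg_left ((abs_sub _ _).trans (by linarith [hu q])) (abs_nonneg t)
    rw [htr, hmean]
    set m := ∫ y, G y ∂(Measure.pi fun _ => P) with hm
    have hmeasE : Measurable fun q => Real.exp (t * (F q - m)) := by fun_prop
    rw [show (fun q => Real.exp (t * (f (e.symm q) - m))) = fun q => Real.exp (t * (F q - m))
      from rfl, integral_prod_symm _ (integrable_of_abs_le hmeasE (hexp F m hFC))]
    have hinner : ∀ y, ∫ x, Real.exp (t * (F (x, y) - m)) ∂P ≤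
        Real.exp (c ^ 2 * t ^ 2 / 8) * Real.exp (t * (G y - m)) := fun y => by
      have h1 := integral_exp_le_of_oscillation P (hsec y) (c := c) (fun x x' => by
        have := hc (e.symm (x', y)) 0 x
        rw [hsymm, Fin.update_cons_zero] at this
        simp only [F, hsymm]
        exact this) t
      calc _ = ∫ x, Real.exp (t * (F (x, y) - G y)) * Real.exp (t * (G y - m)) ∂P := by
            refine integral_congr_ae (Filter.Eventually.of_forall fun x => ?_)
            simp only [← Real.exp_add]
            ring_nf
        _ = (∫ x, Real.exp (t * (F (x, y) - G y)) ∂P) * Real.exp (t * (G y - m)) :=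
            integral_mul_const _ _
        _ ≤ _ := mul_le_mul_of_nonneg_right h1 (Real.exp_nonneg _)
    have hGint : Integrable (fun y => Real.exp (t * (G y - m))) (Measure.pi fun _ => P) :=
      integrable_of_abs_le (by fun_prop) (hexp G m hGC)
    calc _ ≤ ∫ y, Real.exp (c ^ 2 * t ^ 2 / 8) * Real.exp (t * (G y - m))
            ∂(Measure.pi fun _ => P) := by
          refine integral_mono ?_ (hGint.const_mul _) hinner
          exact (integrable_of_abs_le hmeasE (hexp F m hFC)).integral_prod_right
      _ = Real.exp (c ^ 2 * t ^ 2 / 8) * ∫ y, Real.exp (t * (G y - m))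
            ∂(Measure.pi fun _ => P) := integral_const_mul _ _
      _ ≤ Real.exp (c ^ 2 * t ^ 2 / 8) * Real.exp (n * (c ^ 2 * t ^ 2 / 8)) := by
          refine mul_le_mul_of_nonneg_left ?_ (Real.exp_nonneg _)
          refine ih G hG ⟨C, hGC⟩ fun z i x => hGF _ _ fun x' => ?_
          have := hc (e.symm (x', z)) i.succ x
          rw [hsymm, ← Fin.cons_update] at this
          simp only [F, hsymm]
          exact this
      _ = _ := by
          rw [← Real.exp_add]
          push_cast
          ring_nf

/-- **McDiarmid's inequality** for identically distributed arguments. -/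
theorem measure_ge_le_of_boundedDifferences (P : Measure Ω) [IsProbabilityMeasure P] {n : ℕ}
    {c : ℝ} (hc0 : 0 < c) (hn : 0 < n) {f : (Fin n → Ω) → ℝ} (hf : Measurable f)
    (hC : ∃ C, ∀ z, |f z| ≤ C) (hc : ∀ z i x, f (Function.update z i x) - f z ≤ c)
    {ε : ℝ} (hε : 0 ≤ ε) :
    (Measure.pi fun _ => P).real {z | ∫ y, f y ∂(Measure.pi fun _ => P) + ε ≤ f z} ≤
      Real.exp (-(2 * ε ^ 2 / (n * c ^ 2))) := by
  set m := ∫ y, f y ∂(Measure.pi fun _ => P) with hm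
  have hn' : (0 : ℝ) < n := by exact_mod_cast hn
  set t := 4 * ε / (n * c ^ 2) with ht
  have ht0 : 0 ≤ t := by positivity
  obtain ⟨C, hC'⟩ := hC
  have hint : Integrable (fun z => Real.exp (t * (f z - m))) (Measure.pi fun _ => P) := by
    refine integrable_of_abs_le (C := Real.exp (|t| * (C + |m|))) (by fun_prop) fun z => ?_
    rw [Real.abs_exp]
    refine Real.exp_le_exp.2 ((le_abs_self _).trans ?_)
    rw [abs_mul]
    exact mul_le_mul_of_nonneg_left ((abs_sub _ _).trans (by linarith [hC' z])) (abs_nonneg t)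
  have h1 := ProbabilityTheory.measure_ge_le_exp_mul_mgf (μ := Measure.pi fun _ => P)
    (X := fun z => f z - m) ε ht0 hint
  have h2 := integral_exp_le_of_boundedDifferences P t n f hf ⟨C, hC'⟩ hc
  have h3 : {z | m + ε ≤ f z} = {z | ε ≤ f z - m} := by
    ext z
    simp only [Set.mem_ofPred_eq]
    constructor <;> intro h <;> linarith
  rw [h3]
  refine h1.trans ((mul_le_mul_of_nonneg_left h2 (Real.exp_nonneg _)).trans (le_of_eq ?_))
  rw [← Real.exp_add]
  congr 1
  rw [ht]
  field_simp
  ring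

end BoundedDifferences

/-! ### Random signs -/

section Signs

variable {ι : Type*} [Fintype ι] [DecidableEq ι]

theorem label_not (y : Bool) : label (!y) = -label y := by cases y <;> simp [label]

theorem label_mul_self (y : Bool) : label y * label y = 1 := by cases y <;> simp [label]

/-- Flipping the sign of one index permutes the sign vectors. -/
theorem sum_signs_flip {M : Type*} [AddCommMonoid M] (i : ι) (f : (ι → Bool) → M) :
    ∑ s, f (Function.update s i (!s i)) = ∑ s, f s :=
  Function.Bijective.sum_comp (Function.Involutive.bijective fun s => by
    ext j
    by_cases h : j = i
    · subst h; simp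
    · simp [h]) f

theorem sum_signs_not {M : Type*} [AddCommMonoid M] (f : (ι → Bool) → M) :
    ∑ s : ι → Bool, f (fun i => !s i) = ∑ s, f s :=
  Function.Bijective.sum_comp (Function.Involutive.bijective fun s => by simp) f

/-- A sum of `N` random signs has expected absolute value at most `√N`. -/
theorem sum_abs_sum_label_le :
    ∑ s : ι → Bool, |∑ i, label (s i)| ≤
      Fintype.card (ι → Bool) * √(Fintype.card ι) := by
  have horth : ∀ i j, i ≠ j → ∑ s : ι → Bool, label (s i) * label (s j) = 0 := by
    intro i j hij
    have h := sum_signs_flip i fun s : ι → Bool => label (s i) * label (s j)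
    simp only [Function.update_self, Function.update_of_ne hij.symm, label_not, neg_mul,
      Finset.sum_neg_distrib] at h
    linarith
  have hsq : ∑ s : ι → Bool, |∑ i, label (s i)| ^ 2 =
      Fintype.card (ι → Bool) * Fintype.card ι := by
    simp only [sq_abs]
    simp only [sq, Finset.sum_mul_sum]
    rw [Finset.sum_comm]
    have : ∀ i, ∑ s : ι → Bool, ∑ j, label (s i) * label (s j) = Fintype.card (ι → Bool) := by
      intro i
      rw [Finset.sum_comm, Finset.sum_eq_single i]
      · simp [label_mul_self]
      · intro j _ hj
        exact horth i j hj.symm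
      · simp
    simp only [this, Finset.sum_const, Finset.card_univ, nsmul_eq_mul]
    ring
  have hcs := sq_sum_le_card_mul_sum_sq (s := (Finset.univ : Finset (ι → Bool)))
    (f := fun s => |∑ i, label (s i)|)
  rw [hsq, Finset.card_univ] at hcs
  refine le_of_sq_le_sq ?_ (by positivity) |>.trans le_rfl
  rw [mul_pow, Real.sq_sqrt (by positivity)]
  linarith

end Signs

/-! ### Symmetrization -/

section Symmetrization

variable {Ω : Type*} [MeasurableSpace Ω]

/-- Resampling one coordinate does not change a product of copies of `P`. -/
theorem measurePreserving_update {ι : Type*} [Fintype ι] [DecidableEq ι] (P : Measure Ω)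
    [IsProbabilityMeasure P] (i : ι) :
    MeasurePreserving (fun q : (ι → Ω) × Ω => Function.update q.1 i q.2)
      ((Measure.pi fun _ => P).prod P) (Measure.pi fun _ => P) := by
  have hm : Measurable fun q : (ι → Ω) × Ω => Function.update q.1 i q.2 := by
    refine measurable_pi_lambda _ fun j => ?_
    by_cases h : j = i
    · subst h; simpa using measurable_snd
    · simp only [Function.update_of_ne h]
      exact (measurable_pi_apply j).comp measurable_fst
  refine ⟨hm, (Measure.pi_eq fun s hs => ?_).symm⟩
  rw [Measure.map_apply hm (MeasurableSet.univ_pi hs)]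
  have hpre : (fun q : (ι → Ω) × Ω => Function.update q.1 i q.2) ⁻¹' Set.univ.pi s =
      Set.univ.pi (Function.update s i Set.univ) ×ˢ s i := by
    ext q
    simp only [Set.mem_preimage, Set.mem_pi, Set.mem_univ, true_imp_iff, Set.mem_prod]
    constructor
    · intro h
      refine ⟨fun j => ?_, by simpa using h i⟩
      by_cases hj : j = i
      · subst hj; simp
      · simpa [hj] using h j
    · rintro ⟨h1, h2⟩ j
      by_cases hj : j = i
      · subst hj; simpa using h2
      · simpa [hj] using h1 j
  rw [hpre, Measure.prod_prod, Measure.pi_pi, ← Finset.mul_prod_erase _ _ (Finset.mem_univ i),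
    ← Finset.mul_prod_erase (a := i) _ (fun j => P (s j)) (Finset.mem_univ i)]
  simp only [Function.update_self, measure_univ, one_mul]
  rw [mul_comm]
  congr 1
  refine Finset.prod_congr rfl fun j hj => ?_
  rw [Function.update_of_ne (Finset.ne_of_mem_erase hj)]

variable {K : Type*}

/-- The expected maximum over `k` of `c * E g k + ∑ i, v i * g k (x i)` for independent `x i` of
law `P`. -/
noncomputable def expMax (P : Measure Ω) (g : K → Ω → ℝ) {ι : Type*} [Fintype ι] (v : ι → ℝ)
    (c : ℝ) : ℝ :=
  ∫ x, ⨆ k, (c * ∫ y, g k y ∂P + ∑ i, v i * g k (x i)) ∂(Measure.pi fun _ : ι => P)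

variable {P : Measure Ω} {g : K → Ω → ℝ} {ι : Type*} [Fintype ι]

theorem expMax_mul {θ : ℝ} (hθ : 0 ≤ θ) (v : ι → ℝ) (c : ℝ) :
    expMax P g (θ • v) (θ * c) = θ * expMax P g v c := by
  rw [expMax, expMax, ← integral_const_mul]
  refine integral_congr_ae (Filter.Eventually.of_forall fun x => ?_)
  simp only
  rw [Real.mul_iSup_of_nonneg hθ]
  simp only [Pi.smul_apply, smul_eq_mul, mul_add, Finset.mul_sum, mul_assoc]

theorem expMax_comp_equiv [IsProbabilityMeasure P] (v : ι → ℝ) (c : ℝ) (σ : Equiv.Perm ι) :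
    expMax P g (v ∘ σ) c = expMax P g v c := by
  have he := measurePreserving_piCongrLeft (fun _ : ι => P) σ
  rw [eq_comm, expMax, expMax, ← he.integral_comp']
  refine integral_congr_ae (Filter.Eventually.of_forall fun x => ?_)
  simp only
  congr 1
  ext k
  congr 1
  rw [← Equiv.sum_comp σ]
  refine Finset.sum_congr rfl fun i _ => ?_
  rw [MeasurableEquiv.coe_piCongrLeft, Equiv.piCongrLeft_apply_apply]
  rfl

/-- By symmetry, the expected maximum for a vector that is constant on a set and zero elsewhere
depends only on the size of the set. -/
theorem expMax_ite_congr [IsProbabilityMeasure P] [DecidableEq ι] {A B : Finset ι} (h : A.card = B.card) (r c : ℝ) :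
    expMax P g (fun i => if i ∈ A then r else 0) c =
      expMax P g (fun i => if i ∈ B then r else 0) c := by
  let e : {i // i ∈ A} ≃ {i // i ∈ B} := Finset.equivOfCardEq h
  rw [← expMax_comp_equiv (fun i => if i ∈ B then r else 0) c e.extendSubtype]
  congr 1
  ext i
  by_cases hi : i ∈ A
  · simp [hi, e.extendSubtype_mem i hi]
  · simp [hi, e.extendSubtype_not_mem i hi]

variable [Finite K]

theorem le_iSup_of_finite (a : K → ℝ) (k : K) : a k ≤ ⨆ k, a k :=
  le_ciSup (Set.finite_range a).bddAbove k

theorem measurable_max (hg : ∀ k, Measurable (g k)) (v : ι → ℝ) (p : K → ℝ) :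
    Measurable fun x : ι → Ω => ⨆ k, (p k + ∑ i, v i * g k (x i)) := by
  have := Finite.to_countable (α := K)
  refine Measurable.iSup fun k => measurable_const.add ?_
  exact Finset.measurable_sum _ fun i _ => ((hg k).comp (measurable_pi_apply i)).const_mul _

variable [Nonempty K] [IsProbabilityMeasure P]

theorem abs_iSup_le {a : K → ℝ} {C : ℝ} (h : ∀ k, |a k| ≤ C) : |⨆ k, a k| ≤ C := by
  obtain ⟨k0⟩ := ‹Nonempty K›
  have : Nonempty K := ⟨k0⟩
  rw [abs_le]
  exact ⟨(abs_le.1 (h k0)).1.trans (le_iSup_of_finite a k0), ciSup_le fun k => (abs_le.1 (h k)).2⟩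

theorem abs_max_le {C : ℝ} (hC : ∀ k x, |g k x| ≤ C) (v : ι → ℝ) (c : ℝ) (x : ι → Ω) :
    |⨆ k, (c * ∫ y, g k y ∂P + ∑ i, v i * g k (x i))| ≤ |c| * C + ∑ i, |v i| * C := by
  refine abs_iSup_le fun k => (abs_add_le _ _).trans (add_le_add ?_ ?_)
  · rw [abs_mul]
    refine mul_le_mul_of_nonneg_left ?_ (abs_nonneg c)
    have := norm_integral_le_of_norm_le_const (μ := P) (f := g k)
      (Filter.Eventually.of_forall fun x => hC k x)
    simpa using this
  · refine (Finset.abs_sum_le_sum_abs _ _).trans (Finset.sum_le_sum fun i _ => ?_)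
    rw [abs_mul]
    exact mul_le_mul_of_nonneg_left (hC _ _) (abs_nonneg _)

theorem integrable_max (hg : ∀ k, Measurable (g k)) {C : ℝ} (hC : ∀ k x, |g k x| ≤ C) (v : ι → ℝ)
    (c : ℝ) : Integrable (fun x : ι → Ω => ⨆ k, (c * ∫ y, g k y ∂P + ∑ i, v i * g k (x i)))
      (Measure.pi fun _ : ι => P) :=
  integrable_of_abs_le (measurable_max hg v _) (abs_max_le hC v c)

theorem expMax_add_le (hg : ∀ k, Measurable (g k)) {C : ℝ} (hC : ∀ k x, |g k x| ≤ C)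
    (v w : ι → ℝ) (c d : ℝ) :
    expMax P g (v + w) (c + d) ≤ expMax P g v c + expMax P g w d := by
  rw [expMax, expMax, expMax, ← integral_add (integrable_max hg hC v c) (integrable_max hg hC w d)]
  refine integral_mono (integrable_max hg hC _ _)
    ((integrable_max hg hC v c).add (integrable_max hg hC w d)) fun x => ciSup_le fun k => ?_
  have h1 := le_iSup_of_finite (fun k => c * ∫ y, g k y ∂P + ∑ i, v i * g k (x i)) k
  have h2 := le_iSup_of_finite (fun k => d * ∫ y, g k y ∂P + ∑ i, w i * g k (x i)) k
  simp only [Pi.add_apply, add_mul, Finset.sum_add_distrib] at h1 h2 ⊢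
  linarith

/-- By Jensen's inequality, replacing `g k (x i)` by its expectation decreases the expected
maximum. -/
theorem expMax_update_le [DecidableEq ι] (hg : ∀ k, Measurable (g k)) {C : ℝ}
    (hC : ∀ k x, |g k x| ≤ C) (v : ι → ℝ) (c : ℝ) (i : ι) :
    expMax P g (Function.update v i 0) (c + v i) ≤ expMax P g v c := by
  have hmp := measurePreserving_update P i
  have hsplit : ∀ (w : ι → ℝ) k (x : ι → Ω), ∑ j, w j * g k (x j) =
      w i * g k (x i) + ∑ j ∈ Finset.univ.erase i, w j * g k (x j) := fun w k x =>
    (Finset.add_sum_erase _ _ (Finset.mem_univ i)).symm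
  have hΦ : Integrable (fun q : (ι → Ω) × Ω => ⨆ k, (c * ∫ y, g k y ∂P +
      ∑ j, v j * g k (Function.update q.1 i q.2 j))) ((Measure.pi fun _ => P).prod P) :=
    integrable_of_abs_le ((measurable_max hg v _).comp hmp.measurable)
      fun q => abs_max_le hC v c _
  have h1 : expMax P g v c = ∫ x, ∫ y, ⨆ k, (c * ∫ y, g k y ∂P +
      ∑ j, v j * g k (Function.update x i y j)) ∂P ∂(Measure.pi fun _ => P) := by
    have := integral_map hmp.measurable.aemeasurable
      (f := fun x => ⨆ k, (c * ∫ y, g k y ∂P + ∑ j, v j * g k (x j)))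
      (by rw [hmp.map_eq]; exact (measurable_max hg v _).aestronglyMeasurable)
    rw [hmp.map_eq] at this
    exact this.trans (integral_prod _ hΦ)
  rw [h1, expMax]
  refine integral_mono (integrable_max hg hC _ _) hΦ.integral_prod_left fun x =>
    ciSup_le fun k => ?_
  have hgi : Integrable (fun y => v i * g k y) P :=
    (integrable_of_abs_le (hg k) (hC k)).const_mul _
  have hupd : ∀ y k', ∑ j ∈ Finset.univ.erase i, v j * g k' (Function.update x i y j) =
      ∑ j ∈ Finset.univ.erase i, v j * g k' (x j) := fun y k' =>
    Finset.sum_congr rfl fun j hj => by rw [Function.update_of_ne (Finset.ne_of_mem_erase hj)]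
  have hzero : ∑ j ∈ Finset.univ.erase i, Function.update v i 0 j * g k (x j) =
      ∑ j ∈ Finset.univ.erase i, v j * g k (x j) :=
    Finset.sum_congr rfl fun j hj => by rw [Function.update_of_ne (Finset.ne_of_mem_erase hj)]
  calc _ = ∫ y, ((c * ∫ y, g k y ∂P) + ∑ j ∈ Finset.univ.erase i, v j * g k (x j)) +
          v i * g k y ∂P := by
        rw [integral_add (integrable_const _) hgi, integral_const_mul, hsplit, hzero]
        simp
        ring
    _ ≤ _ := by
        refine integral_mono ((integrable_const _).add hgi) ?_ fun y => ?_
        · refine integrable_of_abs_le ((measurable_max hg v _).comp ?_) fun y => abs_max_le hC v c _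
          exact hmp.measurable.comp measurable_prodMk_left
        · refine le_trans (le_of_eq ?_) (le_iSup_of_finite (fun k => c * ∫ y, g k y ∂P +
            ∑ j, v j * g k (Function.update x i y j)) k)
          simp only
          rw [hsplit, hupd, Function.update_self]
          ring

theorem expMax_zero_on_le [DecidableEq ι] (hg : ∀ k, Measurable (g k)) {C : ℝ}
    (hC : ∀ k x, |g k x| ≤ C) (v : ι → ℝ) (c : ℝ) (S : Finset ι) :
    expMax P g (fun i => if i ∈ S then 0 else v i) (c + ∑ i ∈ S, v i) ≤ expMax P g v c := by
  induction S using Finset.induction_on with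
  | empty => simp
  | insert a S ha ih =>
    refine le_trans (le_of_eq ?_) ((expMax_update_le hg hC _ _ a).trans ih)
    rw [Finset.sum_insert ha]
    congr 1
    · ext i
      by_cases h : i = a
      · subst h; simp
      · simp [h]
    · simp only [ha, if_false]
      ring

theorem expMax_sum_le [DecidableEq ι] (hg : ∀ k, Measurable (g k)) {C : ℝ}
    (hC : ∀ k x, |g k x| ≤ C) {α : Type*} (s : Finset α) (v : α → ι → ℝ) (c : α → ℝ) :
    expMax P g (∑ a ∈ s, v a) (∑ a ∈ s, c a) ≤ ∑ a ∈ s, expMax P g (v a) (c a) := by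
  classical
  induction s using Finset.induction_on with
  | empty => simp [expMax]
  | insert a s ha ih =>
    rw [Finset.sum_insert ha, Finset.sum_insert ha, Finset.sum_insert ha]
    exact (expMax_add_le hg hC _ _ _ _).trans (by linarith)

/-- Averaging over subsets: spreading the same total weight over a larger set decreases the
expected maximum. -/
theorem expMax_spread_le [DecidableEq ι] (hg : ∀ k, Measurable (g k)) {C : ℝ}
    (hC : ∀ k x, |g k x| ≤ C) (r c : ℝ) {A B : Finset ι} (hA : A.Nonempty)
    (hAB : A.card ≤ B.card) :
    expMax P g (fun i => if i ∈ B then r / B.card else 0) c ≤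
      expMax P g (fun i => if i ∈ A then r / A.card else 0) c := by
  obtain ⟨d, hd⟩ := Nat.exists_eq_add_of_le hAB
  induction d generalizing B with
  | zero =>
    rw [← expMax_ite_congr (A := A) (B := B) (by omega), hd]
    simp
  | succ d ih =>
    have hApos := hA.card_pos
    have hB0 : (0 : ℝ) < B.card := by exact_mod_cast (by omega : 0 < B.card)
    have hB1 : (0 : ℝ) < (B.card : ℝ) - 1 := by
      have : (1 : ℝ) < B.card := by exact_mod_cast (by omega : 1 < B.card)
      linarith
    have hcard : ∀ b ∈ B, (B.erase b).card = A.card + d := fun b hb => by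
      rw [Finset.card_erase_of_mem hb]; omega
    have hcard' : ∀ b ∈ B, ((B.erase b).card : ℝ) = (B.card : ℝ) - 1 := fun b hb => by
      rw [Finset.cast_card_erase_of_mem hb]
    -- the vector on `B` is the average of the vectors on the sets `B.erase b`
    have hv : (fun i => if i ∈ B then r / B.card else 0) =
        ∑ b ∈ B, (1 / (B.card : ℝ)) •
          fun i => if i ∈ B.erase b then r / ((B.card : ℝ) - 1) else 0 := by
      ext i
      simp only [Finset.sum_apply, Pi.smul_apply, smul_eq_mul, ← Finset.mul_sum]
      by_cases hi : i ∈ B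
      · have : ∑ b ∈ B, (if i ∈ B.erase b then r / ((B.card : ℝ) - 1) else 0) = r := by
          rw [← Finset.add_sum_erase _ _ hi]
          simp only [Finset.notMem_erase, if_false, zero_add]
          rw [Finset.sum_congr rfl (g := fun _ => r / ((B.card : ℝ) - 1)) fun b hb => by
            rw [if_pos (Finset.mem_erase.2 ⟨(Finset.ne_of_mem_erase hb).symm, hi⟩)],
            Finset.sum_const, nsmul_eq_mul, hcard' i hi]
          field_simp
        rw [this, if_pos hi]
        ring
      · simp [hi]
    have hc : c = ∑ b ∈ B, (1 / (B.card : ℝ)) * c := by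
      rw [Finset.sum_const, nsmul_eq_mul]
      field_simp
    rw [hv]
    nth_rw 1 [hc]
    clear hc
    refine (expMax_sum_le hg hC _ _ _).trans ?_
    calc _ ≤ ∑ b ∈ B, (1 / (B.card : ℝ)) *
          expMax P g (fun i => if i ∈ A then r / A.card else 0) c := by
          refine Finset.sum_le_sum fun b hb => ?_
          rw [expMax_mul (by positivity)]
          refine mul_le_mul_of_nonneg_left ?_ (by positivity)
          have := ih (B := B.erase b) (by rw [hcard b hb]; omega) (hcard b hb)
          rwa [hcard' b hb] at this
      _ = _ := by
          rw [Finset.sum_const, nsmul_eq_mul]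
          field_simp

/-- Two opposite sign vectors, with `n ≤ |A|` minus signs and `2 n - |A|` minus signs. -/
theorem expMax_signs_add_ge [DecidableEq ι] (hg : ∀ k, Measurable (g k)) {C : ℝ}
    (hC : ∀ k x, |g k x| ≤ C) {n : ℕ} (hn : 0 < n) (hι : Fintype.card ι = 2 * n)
    (B : Finset ι) (hB : B.card = n) (s : ι → Bool) :
    (2 - |∑ i, label (s i)| / (2 * n)) * expMax P g (fun i => if i ∈ B then -1 else 0) n ≤
      expMax P g (fun i => label (s i)) 0 + expMax P g (fun i => label (!s i)) 0 := by
  have hn0 : (0 : ℝ) < n := by exact_mod_cast hn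
  -- it suffices to treat the case of at least `n` minus signs
  suffices key : ∀ s : ι → Bool, n ≤ (Finset.univ.filter fun i => s i = false).card →
      (2 - |∑ i, label (s i)| / (2 * n)) * expMax P g (fun i => if i ∈ B then -1 else 0) n ≤
        expMax P g (fun i => label (s i)) 0 + expMax P g (fun i => label (!s i)) 0 by
    by_cases h : n ≤ (Finset.univ.filter fun i => s i = false).card
    · exact key s h
    · have h2 := key (fun i => !s i) (by
        have h3 := Finset.card_filter_add_card_filter_not (s := (Finset.univ : Finset ι))
          (fun i => s i = false)
        rw [Finset.card_univ, hι] at h3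
        simp only [Bool.not_eq_false] at h3
        simp only [Bool.not_eq_false']
        omega)
      simp only [label_not, Finset.sum_neg_distrib, abs_neg, neg_neg] at h2 ⊢
      linarith
  intro s hs
  set A := Finset.univ.filter fun i => s i = false with hA
  have hmem : ∀ i, i ∈ A ↔ s i = false := fun i => by simp [hA]
  obtain ⟨d, hd⟩ := Nat.exists_eq_add_of_le hs
  have hdn : d ≤ n := by
    have := Finset.card_le_univ A
    omega
  have hAc : Aᶜ.card = n - d := by rw [Finset.card_compl, hι, hd]; omega
  have hAc' : (Aᶜ.card : ℝ) = n - d := by rw [hAc, Nat.cast_sub hdn]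
  have hlabA : ∀ i ∈ A, label (s i) = -1 := fun i hi => by simp [label, (hmem i).1 hi]
  have hlabAc : ∀ i ∈ Aᶜ, label (s i) = 1 := fun i hi => by
    have : s i = true := by simpa [hmem] using hi
    simp [label, this]
  have hsumA : ∑ i ∈ A, label (s i) = -(n + d) := by
    rw [Finset.sum_congr rfl hlabA, Finset.sum_const, nsmul_eq_mul, hd]
    push_cast; ring
  have hsumAc : ∑ i ∈ Aᶜ, label (s i) = n - d := by
    rw [Finset.sum_congr rfl hlabAc, Finset.sum_const, nsmul_eq_mul, hAc', mul_one]
  have hsum : |∑ i, label (s i)| = 2 * d := by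
    rw [← Finset.sum_add_sum_compl A, hsumA, hsumAc,
      show -((n : ℝ) + d) + (n - d) = -(2 * d) by ring, abs_neg, abs_of_nonneg (by positivity)]
  -- a set `B'` of exactly `n` minus signs
  obtain ⟨B', hB'A, hB'⟩ := Finset.exists_subset_card_eq hs
  rw [expMax_ite_congr (A := B) (B := B') (hB.trans hB'.symm), hsum]
  have h1 : expMax P g (fun i => if i ∈ B' then -1 else 0) (n - 2 * d) ≤
      expMax P g (fun i => label (s i)) 0 := by
    refine le_trans (le_of_eq ?_) (expMax_zero_on_le hg hC _ 0 B'ᶜ)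
    congr 1
    · ext i
      by_cases hi : i ∈ B'
      · simp [hi, hlabA i (hB'A hi)]
      · simp [hi]
    · have h2 := Finset.sum_add_sum_compl B' fun i => label (s i)
      rw [← Finset.sum_add_sum_compl A, hsumA, hsumAc,
        Finset.sum_congr rfl fun i hi => hlabA i (hB'A hi), Finset.sum_const, nsmul_eq_mul,
        hB'] at h2
      linarith
  have h2 : expMax P g (fun i => if i ∈ Aᶜ then -1 else 0) (n + d) ≤
      expMax P g (fun i => label (!s i)) 0 := by
    refine le_trans (le_of_eq ?_) (expMax_zero_on_le hg hC _ 0 A)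
    simp only [label_not, Finset.sum_neg_distrib, hsumA]
    congr 1
    · ext i
      by_cases hi : i ∈ A
      · simp [hi]
      · simp [hi, hlabAc i (Finset.mem_compl.2 hi)]
    · ring
  have h3 : expMax P g (fun i => if i ∈ B' then -(n - d) / n else 0) (n + d) ≤
      expMax P g (fun i => if i ∈ Aᶜ then -1 else 0) (n + d) := by
    rcases hdn.eq_or_lt with rfl | hlt
    · have hAe : Aᶜ = ∅ := by rw [← Finset.card_eq_zero, hAc]; omega
      simp [hAe]
    · have hne : Aᶜ.Nonempty := by rw [← Finset.card_pos, hAc]; omega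
      have hpos : (0 : ℝ) < n - d := by
        have : (d : ℝ) < n := by exact_mod_cast hlt
        linarith
      have := expMax_spread_le (P := P) hg hC (-((n : ℝ) - d)) (n + d) (A := Aᶜ) (B := B') hne
        (by rw [hAc, hB']; omega)
      rwa [hAc', hB', neg_div ((n : ℝ) - d) ((n : ℝ) - d), div_self hpos.ne'] at this
  have hθ : (0 : ℝ) ≤ 2 - 2 * d / (2 * n) := by
    have : (d : ℝ) / n ≤ 1 := by
      rw [div_le_one hn0]; exact_mod_cast hdn
    rw [mul_div_mul_left _ _ two_ne_zero]
    linarith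
  rw [← expMax_mul hθ]
  refine le_trans (le_of_eq ?_) ((expMax_add_le hg hC _ _ _ _).trans
    (add_le_add h1 (h3.trans h2)))
  congr 1
  · ext i
    by_cases hi : i ∈ B'
    · simp only [hi, Pi.smul_apply, Pi.add_apply, if_true, smul_eq_mul]
      field_simp
      ring
    · simp [hi]
  · field_simp
    ring

/-- **Symmetrization with `2 n` signs.** The expected maximal deviation of `n` samples is bounded
by the average over the sign vectors of length `2 n`, up to the factor `1 - 1 / (2 √(2 n))`. The
usual symmetrization has `2` times the average over sign vectors of length `n` instead, which is
larger by a factor of about `√2`. -/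
theorem integral_iSup_sub_le {n : ℕ} (hn : 0 < n) (hg : ∀ k, Measurable (g k)) {C : ℝ}
    (hC : ∀ k x, |g k x| ≤ C) {R : ℝ}
    (hR : ∀ x : Fin n ⊕ Fin n → Ω, ∑ s : Fin n ⊕ Fin n → Bool,
      ⨆ k, ∑ i, label (s i) * g k (x i) ≤ Fintype.card (Fin n ⊕ Fin n → Bool) * R) :
    (1 - 1 / (2 * √(2 * n))) *
      ∫ z, ⨆ k, (n * ∫ y, g k y ∂P - ∑ i, g k (z i)) ∂(Measure.pi fun _ : Fin n => P) ≤ R := by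
  have hn0 : (0 : ℝ) < n := by exact_mod_cast hn
  have hι : Fintype.card (Fin n ⊕ Fin n) = 2 * n := by simp; ring
  let B : Finset (Fin n ⊕ Fin n) := Finset.univ.map Function.Embedding.inl
  have hB : B.card = n := by simp [B]
  have hΔ : ∫ z, ⨆ k, (n * ∫ y, g k y ∂P - ∑ i, g k (z i)) ∂(Measure.pi fun _ : Fin n => P) =
      expMax P g (fun i => if i ∈ B then -1 else 0) n := by
    have hmp := (measurePreserving_fst (μ := Measure.pi fun _ : Fin n => P)
      (ν := Measure.pi fun _ : Fin n => P)).comp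
      (measurePreserving_sumPiEquivProdPi fun _ : Fin n ⊕ Fin n => P)
    have hmeas : Measurable fun z : Fin n → Ω => ⨆ k, (n * ∫ y, g k y ∂P - ∑ i, g k (z i)) := by
      simpa [sub_eq_add_neg] using measurable_max hg (fun _ : Fin n => -1)
        (fun k => n * ∫ y, g k y ∂P)
    rw [← hmp.map_eq, integral_map hmp.measurable.aemeasurable hmeas.aestronglyMeasurable, expMax]
    refine integral_congr_ae (Filter.Eventually.of_forall fun x => ?_)
    simp only
    congr 1
    ext k
    rw [Fintype.sum_sum_type]
    simp [B, MeasurableEquiv.sumPiEquivProdPi, Equiv.sumPiEquivProdPi, sub_eq_add_neg]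
  rw [hΔ]
  set Δ := expMax P g (fun i => if i ∈ B then -1 else 0) n with hΔdef
  have hΔ0 : 0 ≤ Δ := by
    refine le_trans (le_of_eq ?_) (expMax_zero_on_le hg hC _ _ B)
    rw [Finset.sum_congr rfl fun i hi => if_pos hi, Finset.sum_const, hB]
    have : (fun i => if i ∈ B then (0 : ℝ) else if i ∈ B then -1 else 0) = 0 := by
      ext i
      by_cases hi : i ∈ B <;> simp [hi]
    rw [this]
    simp [expMax]
  set N : ℝ := (Fintype.card (Fin n ⊕ Fin n → Bool) : ℝ) with hN
  have hN0 : 0 < N := by rw [hN]; exact_mod_cast Fintype.card_pos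
  have hsum : ∑ s : Fin n ⊕ Fin n → Bool, expMax P g (fun i => label (s i)) 0 ≤ N * R := by
    simp only [expMax]
    rw [← integral_finsetSum _ fun s _ => integrable_max hg hC _ _]
    calc _ ≤ ∫ _x, N * R ∂(Measure.pi fun _ : Fin n ⊕ Fin n => P) := by
          refine integral_mono (integrable_finsetSum _ fun s _ => integrable_max hg hC _ _)
            (integrable_const _) fun x => ?_
          simpa using hR x
      _ = _ := by simp
  have h1 := Finset.sum_le_sum fun (s : Fin n ⊕ Fin n → Bool) (_ : s ∈ Finset.univ) =>
    expMax_signs_add_ge (P := P) hg hC hn hι B hB s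
  rw [Finset.sum_add_distrib, sum_signs_not fun s => expMax P g (fun i => label (s i)) 0,
    ← Finset.sum_mul, Finset.sum_sub_distrib, ← Finset.sum_div, Finset.sum_const,
    Finset.card_univ, nsmul_eq_mul, ← hN] at h1
  have h2 := sum_abs_sum_label_le (ι := Fin n ⊕ Fin n)
  rw [hι, ← hN] at h2
  push_cast at h2
  have h3 : N * (2 - 1 / √(2 * n)) * Δ ≤ 2 * (N * R) := by
    have hsq : √(2 * n) / (2 * n) = 1 / √(2 * n) := Real.sqrt_div_self'
    calc _ = (N * 2 - N * √(2 * n) / (2 * n)) * Δ := by rw [mul_div_assoc, hsq]; ring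
      _ ≤ (N * 2 - (∑ s : Fin n ⊕ Fin n → Bool, |∑ i, label (s i)|) / (2 * n)) * Δ := by
          refine mul_le_mul_of_nonneg_right ?_ hΔ0
          gcongr
      _ ≤ _ := by linarith
  have h4 : N * ((1 - 1 / (2 * √(2 * n))) * Δ) ≤ N * R := by
    have : (1 : ℝ) / (2 * √(2 * n)) = 1 / √(2 * n) / 2 := by rw [mul_comm, div_div]
    rw [this]
    linarith
  exact le_of_mul_le_mul_left h4 hN0

end Symmetrization

/-! ### Averages over sign vectors -/

section Contraction

variable {K ι : Type*} [Finite K] [Nonempty K]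

theorem iSup_add_iSup_le_of_lipschitz {φ : ℝ → ℝ} (hφ : ∀ a b, |φ a - φ b| ≤ |a - b|)
    (A u : K → ℝ) (ε : ℝ) :
    (⨆ k, (A k + ε * φ (u k))) + (⨆ k, (A k + -ε * φ (u k))) ≤
      (⨆ k, (A k + ε * u k)) + (⨆ k, (A k + -ε * u k)) := by
  obtain ⟨k, hk⟩ := exists_eq_ciSup_of_finite (f := fun k => A k + ε * φ (u k))
  obtain ⟨l, hl⟩ := exists_eq_ciSup_of_finite (f := fun k => A k + -ε * φ (u k))
  rw [← hk, ← hl]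
  have h1 : ε * (φ (u k) - φ (u l)) ≤ |ε * (u k - u l)| := by
    refine (le_abs_self _).trans ?_
    rw [abs_mul, abs_mul]
    exact mul_le_mul_of_nonneg_left (hφ _ _) (abs_nonneg ε)
  have h2 := le_iSup_of_finite (fun k => A k + ε * u k)
  have h3 := le_iSup_of_finite (fun k => A k + -ε * u k)
  rcases abs_cases (ε * (u k - u l)) with ⟨h, -⟩ | ⟨h, -⟩
  · linarith [h2 k, h3 l]
  · linarith [h2 l, h3 k]

/-- The contraction principle of Ledoux and Talagrand: composing with a 1-Lipschitz function does
not increase the average, over the sign vectors, of the maximal signed sum. -/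
theorem sum_signs_contraction [Fintype ι] [DecidableEq ι] {φ : ℝ → ℝ} (hφ : ∀ a b, |φ a - φ b| ≤ |a - b|)
    (u : K → ι → ℝ) :
    ∑ s : ι → Bool, ⨆ k, ∑ i, label (s i) * φ (u k i) ≤
      ∑ s : ι → Bool, ⨆ k, ∑ i, label (s i) * u k i := by
  -- `φ` is removed from one index after the other
  suffices key : ∀ S : Finset ι, ∑ s : ι → Bool, ⨆ k, ∑ i, label (s i) * φ (u k i) ≤
      ∑ s : ι → Bool, ⨆ k, ∑ i, label (s i) * (if i ∈ S then u k i else φ (u k i)) by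
    simpa using key Finset.univ
  intro S
  induction S using Finset.induction_on with
  | empty => simp
  | insert a S ha ih =>
    refine ih.trans ?_
    let A : (ι → Bool) → K → ℝ := fun s k =>
      ∑ i ∈ Finset.univ.erase a, label (s i) * (if i ∈ S then u k i else φ (u k i))
    have hflip : ∀ s, A (Function.update s a (!s a)) = A s := fun s => by
      ext k
      refine Finset.sum_congr rfl fun i hi => ?_
      rw [Function.update_of_ne (Finset.ne_of_mem_erase hi)]
    have hl : ∀ s k, ∑ i, label (s i) * (if i ∈ S then u k i else φ (u k i)) =
        A s k + label (s a) * φ (u k a) := fun s k => by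
      rw [← Finset.add_sum_erase _ _ (Finset.mem_univ a), if_neg ha, add_comm]
    have hr : ∀ s k, ∑ i, label (s i) * (if i ∈ insert a S then u k i else φ (u k i)) =
        A s k + label (s a) * u k a := fun s k => by
      rw [← Finset.add_sum_erase _ _ (Finset.mem_univ a), if_pos (Finset.mem_insert_self a S),
        add_comm]
      congr 1
      refine Finset.sum_congr rfl fun i hi => ?_
      simp [Finset.ne_of_mem_erase hi]
    simp only [hl, hr]
    have h1 := sum_signs_flip a fun s : ι → Bool => ⨆ k, (A s k + label (s a) * φ (u k a))
    have h2 := sum_signs_flip a fun s : ι → Bool => ⨆ k, (A s k + label (s a) * u k a)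
    simp only [hflip, Function.update_self, label_not] at h1 h2
    have h3 := Finset.sum_le_sum fun (s : ι → Bool) (_ : s ∈ Finset.univ) =>
      iSup_add_iSup_le_of_lipschitz hφ (A s) (fun k => u k a) (label (s a))
    rw [Finset.sum_add_distrib, Finset.sum_add_distrib] at h3
    linarith

end Contraction

section FiniteClass

variable {ι : Type*} [Fintype ι]

/-- The value `1` on the finite set `A` and `-1` outside. -/
noncomputable def signOf (A : Finset ι) (i : ι) : ℝ := by
  classical exact if i ∈ A then 1 else -1

theorem sum_exp_signs_le [DecidableEq ι] (A : Finset ι) (t : ℝ) :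
    ∑ s : ι → Bool, Real.exp (t * ∑ i, label (s i) * signOf A i) ≤
      Fintype.card (ι → Bool) * Real.exp (Fintype.card ι * (t ^ 2 / 2)) := by
  classical
  have hcosh : ∀ i, ∑ y : Bool, Real.exp (t * (label y * signOf A i)) ≤
      2 * Real.exp (t ^ 2 / 2) := by
    intro i
    have h := Real.cosh_le_exp_half_sq t
    rw [Real.cosh_eq] at h
    rw [Fintype.sum_bool]
    by_cases hi : i ∈ A <;> simp [label, signOf, hi] <;> linarith
  calc _ = ∑ s : ι → Bool, ∏ i, Real.exp (t * (label (s i) * signOf A i)) := by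
        refine Finset.sum_congr rfl fun s _ => ?_
        rw [← Real.exp_sum, Finset.mul_sum]
    _ = ∏ i : ι, ∑ y : Bool, Real.exp (t * (label y * signOf A i)) := by
        rw [Finset.prod_univ_sum, Fintype.piFinset_univ]
    _ ≤ ∏ _i : ι, 2 * Real.exp (t ^ 2 / 2) :=
        Finset.prod_le_prod (fun i _ => Finset.sum_nonneg fun y _ => (Real.exp_pos _).le)
          fun i _ => hcosh i
    _ = _ := by
        rw [Finset.prod_const, mul_pow, ← Real.exp_nat_mul]
        simp

/-- Massart's lemma for sign vectors: the maximal signed sum over `e ^ Λ` of them is on average at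
most `√(2 N Λ)`, where `N` is their length. -/
theorem sum_signs_iSup_le [DecidableEq ι] [Nonempty ι] {J : Type*} [Finite J] [Nonempty J]
    (A : J → Finset ι) (𝒜 : Finset (Finset ι)) (hA : ∀ j, A j ∈ 𝒜) {Λ : ℝ} (hΛ : 0 < Λ)
    (hcard : (𝒜.card : ℝ) ≤ Real.exp Λ) :
    ∑ s : ι → Bool, ⨆ j, ∑ i, label (s i) * signOf (A j) i ≤
      Fintype.card (ι → Bool) * √(2 * Fintype.card ι * Λ) := by
  set N : ℝ := (Fintype.card ι : ℝ) with hN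
  set M : ℝ := (Fintype.card (ι → Bool) : ℝ) with hM
  have hN0 : 0 < N := by rw [hN]; exact_mod_cast Fintype.card_pos
  set t := √(2 * Λ / N) with ht
  have ht0 : 0 < t := Real.sqrt_pos.2 (by positivity)
  have ht2 : N * (t ^ 2 / 2) = Λ := by
    rw [ht, Real.sq_sqrt (by positivity)]
    field_simp
  have htN : t * √(2 * N * Λ) = 2 * Λ := by
    rw [ht, ← Real.sqrt_mul (by positivity),
      show 2 * Λ / N * (2 * N * Λ) = (2 * Λ) ^ 2 by field_simp, Real.sqrt_sq (by positivity)]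
  let m : (ι → Bool) → ℝ := fun s => ⨆ j, ∑ i, label (s i) * signOf (A j) i
  have h1 : ∑ s, Real.exp (t * m s) ≤ M * Real.exp (2 * Λ) := by
    calc _ ≤ ∑ s : ι → Bool, ∑ B ∈ 𝒜, Real.exp (t * ∑ i, label (s i) * signOf B i) := by
          refine Finset.sum_le_sum fun s _ => ?_
          obtain ⟨j, hj⟩ :=
            exists_eq_ciSup_of_finite (f := fun j => ∑ i, label (s i) * signOf (A j) i)
          simp only [m]
          rw [← hj]
          exact Finset.single_le_sum
            (f := fun B => Real.exp (t * ∑ i, label (s i) * signOf B i))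
            (fun B _ => (Real.exp_pos _).le) (hA j)
      _ = ∑ B ∈ 𝒜, ∑ s : ι → Bool, Real.exp (t * ∑ i, label (s i) * signOf B i) :=
          Finset.sum_comm
      _ ≤ ∑ _B ∈ 𝒜, M * Real.exp Λ := by
          refine Finset.sum_le_sum fun B _ => ?_
          have := sum_exp_signs_le B t
          rwa [← hN, ht2] at this
      _ = 𝒜.card * (M * Real.exp Λ) := by rw [Finset.sum_const, nsmul_eq_mul]
      _ ≤ Real.exp Λ * (M * Real.exp Λ) :=
          mul_le_mul_of_nonneg_right hcard (by positivity)
      _ = _ := by rw [two_mul, Real.exp_add]; ring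
  -- Jensen's inequality, in the form `x ≤ c - 1 + exp (x - c)` with `c = 2 Λ`
  have h2 : t * ∑ s, m s ≤ M * (2 * Λ) := by
    calc t * ∑ s, m s ≤ ∑ s, (2 * Λ - 1 + Real.exp (-(2 * Λ)) * Real.exp (t * m s)) := by
          rw [Finset.mul_sum]
          refine Finset.sum_le_sum fun s _ => ?_
          rw [← Real.exp_add]
          linarith [Real.add_one_le_exp (-(2 * Λ) + t * m s)]
      _ = M * (2 * Λ - 1) + Real.exp (-(2 * Λ)) * ∑ s, Real.exp (t * m s) := by
          rw [Finset.sum_add_distrib, Finset.sum_const, ← Finset.mul_sum, Finset.card_univ,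
            nsmul_eq_mul]
      _ ≤ M * (2 * Λ - 1) + Real.exp (-(2 * Λ)) * (M * Real.exp (2 * Λ)) := by gcongr
      _ = M * (2 * Λ) := by
          rw [mul_left_comm, ← Real.exp_add, neg_add_cancel, Real.exp_zero]
          ring
  refine le_of_mul_le_mul_left (h2.trans (le_of_eq ?_)) ht0
  rw [← htN]
  ring

end FiniteClass

section VCDimension

variable {X : Type*} {T : ℕ}

open Classical in
/-- The traces on the points `x i` of the sets where a base-rule exceeds `r`. -/
noncomputable def traces {ι : Type*} [Fintype ι] (hbar : Fin T → X → ℝ) (x : ι → X) (r : ℝ) :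
    Finset (Finset ι) :=
  Finset.univ.image fun j => Finset.univ.filter fun i => r < hbar j (x i)

/-- Index sets shattered by the traces have distinct points `x i`, which are shattered by the
base-rules with constant threshold. -/
theorem vcDim_traces_le {ι : Type*} [Fintype ι] [DecidableEq ι] (hbar : Fin T → X → ℝ) (x : ι → X)
    (r : ℝ) : (traces hbar x r).vcDim ≤ vcDim hbar := by
  classical
  refine Finset.sup_le fun S hS => ?_
  rw [Finset.mem_shatterer] at hS
  have htr : ∀ t ⊆ S, ∃ j, ∀ i ∈ S, i ∈ t ↔ r < hbar j (x i) := by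
    intro t ht
    obtain ⟨u, hu, hut⟩ := hS ht
    simp only [traces, Finset.mem_image, Finset.mem_univ, true_and] at hu
    obtain ⟨j, rfl⟩ := hu
    refine ⟨j, fun i hi => ?_⟩
    rw [← hut]
    simp [hi]
  have hinj : Set.InjOn x S := by
    intro i hi i' hi' hx
    obtain ⟨j, hj⟩ := htr {i} (by simpa using hi)
    have h1 := (hj i hi).1 (Finset.mem_singleton_self i)
    rw [hx] at h1
    exact (Finset.mem_singleton.1 ((hj i' hi').2 h1)).symm
  refine le_csSup (bddAbove_vcDim hbar) ⟨S.image x, Finset.card_image_of_injOn hinj,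
    fun _ => r, fun B _ => ?_⟩
  obtain ⟨j, hj⟩ := htr (S.filter fun i => x i ∈ B) (Finset.filter_subset _ _)
  refine ⟨j, fun y hy => ?_⟩
  obtain ⟨i, hi, rfl⟩ := Finset.mem_image.1 hy
  rw [← hj i hi, Finset.mem_filter]
  exact ⟨fun h => ⟨hi, h⟩, fun h => h.2⟩

/-- The bound `(e N / D) ^ D` for the sum of the binomial coefficients up to `D`. -/
theorem sum_choose_le_exp {N D : ℕ} (hD : 0 < D) (hDN : D ≤ N) :
    ∑ k ∈ Finset.Iic D, (N.choose k : ℝ) ≤ Real.exp (D * (1 + Real.log (N / D))) := by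
  have hD0 : (0 : ℝ) < D := by exact_mod_cast hD
  have hN0 : (0 : ℝ) < N := by exact_mod_cast hD.trans_le hDN
  set q : ℝ := D / N with hq
  have hq0 : 0 < q := by positivity
  have hq1 : q ≤ 1 := by rw [hq, div_le_one hN0]; exact_mod_cast hDN
  have h1 : q ^ D * ∑ k ∈ Finset.Iic D, (N.choose k : ℝ) ≤ Real.exp D := by
    calc _ = ∑ k ∈ Finset.Iic D, q ^ D * (N.choose k : ℝ) := Finset.mul_sum _ _ _
      _ ≤ ∑ k ∈ Finset.Iic D, q ^ k * (N.choose k : ℝ) := by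
          refine Finset.sum_le_sum fun k hk => mul_le_mul_of_nonneg_right ?_ (by positivity)
          exact pow_le_pow_of_le_one hq0.le hq1 (Finset.mem_Iic.1 hk)
      _ ≤ ∑ k ∈ Finset.range (N + 1), q ^ k * (N.choose k : ℝ) := by
          refine Finset.sum_le_sum_of_subset_of_nonneg (fun k hk => ?_)
            fun _ _ _ => by positivity
          rw [Finset.mem_range]
          exact Nat.lt_succ_of_le ((Finset.mem_Iic.1 hk).trans hDN)
      _ = (q + 1) ^ N := by simp [add_pow]
      _ ≤ Real.exp q ^ N := by
          gcongr
          exact Real.add_one_le_exp q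
      _ = Real.exp D := by
          rw [← Real.exp_nat_mul, hq]
          congr 1
          field_simp
  have h2 : Real.exp (D * (1 + Real.log (N / D))) * q ^ D = Real.exp D := by
    have : q = Real.exp (-Real.log (N / D)) := by
      rw [Real.exp_neg, Real.exp_log (by positivity), hq, inv_div]
    rw [this, ← Real.exp_nat_mul, ← Real.exp_add]
    congr 1
    ring
  have hqD : 0 < q ^ D := by positivity
  refine le_of_mul_le_mul_left ?_ hqD
  rw [mul_comm (q ^ D) (Real.exp _), h2]
  exact h1

/-- The Sauer–Shelah lemma. -/
theorem card_traces_le {ι : Type*} [Fintype ι] (hbar : Fin T → X → ℝ) (x : ι → X) (r : ℝ)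
    (hD : 0 < vcDim hbar) (hDN : vcDim hbar ≤ Fintype.card ι) :
    ((traces hbar x r).card : ℝ) ≤
      Real.exp (vcDim hbar * (1 + Real.log (Fintype.card ι / vcDim hbar))) := by
  classical
  refine le_trans ?_ (sum_choose_le_exp hD hDN)
  have h := (Finset.card_le_card_shatterer (traces hbar x r)).trans
    Finset.card_shatterer_le_sum_vcDim
  have h' : ((traces hbar x r).card : ℝ) ≤
      ∑ k ∈ Finset.Iic (traces hbar x r).vcDim, ((Fintype.card ι).choose k : ℝ) := by
    exact_mod_cast h
  refine h'.trans ?_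
  exact Finset.sum_le_sum_of_subset_of_nonneg
    (Finset.Iic_subset_Iic.2 (vcDim_traces_le hbar x r)) fun _ _ _ => by positivity

theorem integral_threshold {t : ℝ} (h1 : -1 ≤ t) (h2 : t ≤ 1) :
    ∫ r in Set.Ioc (-1 : ℝ) 1, (if r < t then (1 : ℝ) else -1) = 2 * t := by
  have hfun : (fun r : ℝ => if r < t then (1 : ℝ) else -1) =
      fun r => (Set.Iio t).indicator (fun _ => (2 : ℝ)) r + -1 := by
    ext r
    by_cases h : r < t
    · simp [h]; norm_num
    · simp [h]
  have hset : Set.Iio t ∩ Set.Ioc (-1 : ℝ) 1 = Set.Ioo (-1) t := by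
    ext r
    simp only [Set.mem_inter_iff, Set.mem_Iio, Set.mem_Ioc, Set.mem_Ioo]
    constructor
    · rintro ⟨h, h', -⟩; exact ⟨h', h⟩
    · rintro ⟨h, h'⟩; exact ⟨h', h, by linarith⟩
  rw [hfun, integral_add ((integrable_const _).indicator measurableSet_Iio) (integrable_const _),
    integral_indicator measurableSet_Iio, Measure.restrict_restrict measurableSet_Iio, hset]
  simp
  rw [max_eq_left (by linarith)]
  ring

/-- The average over the sign vectors of the maximal signed sum of the base-rules. A value
`h ∈ [-1, 1]` is the average over the thresholds `r ∈ [-1, 1]` of the sign of `h - r`, which reduces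
the claim to sign vectors. -/
theorem sum_signs_baseRules_le {ι : Type*} [Fintype ι] [DecidableEq ι] [Nonempty ι]
    (hbar : Fin T → X → ℝ) (hbound : ∀ j x, -1 ≤ hbar j x ∧ hbar j x ≤ 1) (x : ι → X)
    (hD : 0 < vcDim hbar) (hDN : vcDim hbar ≤ Fintype.card ι) :
    ∑ s : ι → Bool, ⨆ j, ∑ i, label (s i) * hbar j (x i) ≤ Fintype.card (ι → Bool) *
      √(2 * Fintype.card ι * (vcDim hbar * (1 + Real.log (Fintype.card ι / vcDim hbar)))) := by
  classical
  have hT : Nonempty (Fin T) := by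
    by_contra hT
    rw [not_nonempty_iff] at hT
    refine hD.ne' (Nat.sSup_def ⟨0, fun m hm => ?_⟩ |>.trans ?_)
    · obtain ⟨S, -, r, hr⟩ := hm
      exact (hT.elim (hr ∅ (Finset.empty_subset S)).choose)
    · rw [Nat.find_eq_zero]
      rintro m ⟨S, -, r, hr⟩
      exact (hT.elim (hr ∅ (Finset.empty_subset S)).choose)
  set D := vcDim hbar
  set Λ : ℝ := D * (1 + Real.log (Fintype.card ι / D)) with hΛ
  have hD0 : (0 : ℝ) < D := by exact_mod_cast hD
  have hΛ0 : 0 < Λ := by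
    have : 0 ≤ Real.log (Fintype.card ι / D) := by
      refine Real.log_nonneg ?_
      rw [le_div_iff₀ hD0, one_mul]
      exact_mod_cast hDN
    positivity
  set b : ℝ := Fintype.card (ι → Bool) * √(2 * Fintype.card ι * Λ) with hb
  let A : ℝ → Fin T → Finset ι := fun r j => Finset.univ.filter fun i => r < hbar j (x i)
  have hsgn : ∀ r j i, signOf (A r j) i = if r < hbar j (x i) then (1 : ℝ) else -1 :=
    fun r j i => by simp [signOf, A]
  let m : (ι → Bool) → ℝ → ℝ := fun s r => ⨆ j, ∑ i, label (s i) * signOf (A r j) i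
  have hterm : ∀ (s : ι → Bool) j, Measurable fun r => ∑ i, label (s i) * signOf (A r j) i := by
    intro s j
    refine Finset.measurable_sum _ fun i _ => Measurable.const_mul ?_ _
    simp only [hsgn]
    exact Measurable.ite measurableSet_Iio measurable_const measurable_const
  have hterm_le : ∀ (s : ι → Bool) j r,
      |∑ i, label (s i) * signOf (A r j) i| ≤ Fintype.card ι := by
    intro s j r
    refine (Finset.abs_sum_le_sum_abs _ _).trans ?_
    calc _ ≤ ∑ _i : ι, (1 : ℝ) := Finset.sum_le_sum fun i _ => by
          rw [hsgn]
          cases s i <;> split_ifs <;> simp [label]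
      _ = _ := by simp
  have hm_int : ∀ s, Integrable (m s) (volume.restrict (Set.Ioc (-1 : ℝ) 1)) := fun s =>
    integrable_of_abs_le (Measurable.iSup fun j => hterm s j) fun r => abs_iSup_le fun j =>
      hterm_le s j r
  have h1 : ∀ s, 2 * ⨆ j, ∑ i, label (s i) * hbar j (x i) ≤
      ∫ r in Set.Ioc (-1 : ℝ) 1, m s r := by
    intro s
    rw [Real.mul_iSup_of_nonneg (by norm_num)]
    refine ciSup_le fun j => ?_
    have hint : ∀ i ∈ Finset.univ, Integrable (fun r => label (s i) * signOf (A r j) i)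
        (volume.restrict (Set.Ioc (-1 : ℝ) 1)) := fun i _ => by
      refine Integrable.const_mul (integrable_of_abs_le (C := 1) ?_ fun r => ?_) _
      · simp only [hsgn]
        exact Measurable.ite measurableSet_Iio measurable_const measurable_const
      · rw [hsgn]; split_ifs <;> simp
    calc 2 * ∑ i, label (s i) * hbar j (x i)
        = ∫ r in Set.Ioc (-1 : ℝ) 1, ∑ i, label (s i) * signOf (A r j) i := by
          rw [integral_finsetSum _ hint, Finset.mul_sum]
          refine Finset.sum_congr rfl fun i _ => ?_
          simp only [hsgn]
          rw [integral_const_mul, integral_threshold (hbound j _).1 (hbound j _).2]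
          ring
      _ ≤ _ := integral_mono (integrable_of_abs_le (hterm s j) fun r => hterm_le s j r)
          (hm_int s) fun r => le_iSup_of_finite
            (fun j => ∑ i, label (s i) * signOf (A r j) i) j
  have h2 : ∑ s, ∫ r in Set.Ioc (-1 : ℝ) 1, m s r ≤ 2 * b := by
    rw [← integral_finsetSum _ fun s _ => hm_int s]
    calc _ ≤ ∫ _r in Set.Ioc (-1 : ℝ) 1, b := by
          refine integral_mono (integrable_finsetSum _ fun s _ => hm_int s)
            (integrable_const _) fun r => ?_
          refine sum_signs_iSup_le (A r) (traces hbar x r) (fun j => ?_) hΛ0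
            (card_traces_le hbar x r hD hDN)
          simp only [traces, Finset.mem_image, Finset.mem_univ, true_and, A]
          exact ⟨j, by congr⟩
      _ = 2 * b := by
          simp
          norm_num
  have h3 := Finset.sum_le_sum fun (s : ι → Bool) (_ : s ∈ Finset.univ) => h1 s
  rw [← Finset.mul_sum] at h3
  linarith

/-- A symmetric class of base-rules bounds its convex hull. -/
theorem sum_label_mul_comb_le {ι : Type*} [Fintype ι] {hbar : Fin T → X → ℝ}
    (hneg : ∀ j, ∃ j', ∀ x, hbar j' x = -hbar j x) (x : ι → X) (s : ι → Bool) {ν : Fin T → ℝ}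
    (hν : norm1 ν ≤ 1) :
    ∑ i, label (s i) * comb hbar ν (x i) ≤ ⨆ j, ∑ i, label (s i) * hbar j (x i) := by
  set E := ⨆ j, ∑ i, label (s i) * hbar j (x i)
  have hE : ∀ j, |∑ i, label (s i) * hbar j (x i)| ≤ E := fun j => by
    obtain ⟨j', hj'⟩ := hneg j
    have h1 := le_iSup_of_finite (fun j => ∑ i, label (s i) * hbar j (x i)) j
    have h2 := le_iSup_of_finite (fun j => ∑ i, label (s i) * hbar j (x i)) j'
    simp only [hj', mul_neg, Finset.sum_neg_distrib] at h2
    rw [abs_le]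
    constructor <;> linarith
  have hE0 : 0 ≤ E := by
    rcases isEmpty_or_nonempty (Fin T) with h | ⟨⟨j⟩⟩
    · simp [E, Real.iSup_of_isEmpty]
    · exact (abs_nonneg _).trans (hE j)
  calc _ = ∑ j, (∑ i, label (s i) * hbar j (x i)) * ν j := by
        simp only [comb, Finset.mul_sum, Finset.sum_mul]
        rw [Finset.sum_comm]
        exact Finset.sum_congr rfl fun j _ => Finset.sum_congr rfl fun i _ => by ring
    _ ≤ ∑ j, E * |ν j| := Finset.sum_le_sum fun j _ => by
        refine (le_abs_self _).trans ?_
        rw [abs_mul]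
        exact mul_le_mul_of_nonneg_right (hE j) (abs_nonneg _)
    _ = E * norm1 ν := by rw [norm1, Finset.mul_sum]
    _ ≤ E := mul_le_of_le_one_right hE0 hν

end VCDimension

/-! ### Uniform deviation of the constraint violation -/

section Deviation

theorem symmetrization_factor_pos {n : ℕ} (hn : 0 < n) : (0 : ℝ) < 1 - 1 / (2 * √(2 * n)) := by
  have h1 : (1 : ℝ) ≤ √(2 * n) := by
    rw [Real.one_le_sqrt]
    have : (1 : ℝ) ≤ n := by exact_mod_cast hn
    linarith
  have h2 : (1 : ℝ) / (2 * √(2 * n)) ≤ 1 / 2 := by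
    apply one_div_le_one_div_of_le <;> linarith
  linarith

variable {Ω : Type*} [MeasurableSpace Ω] {P : Measure Ω} [IsProbabilityMeasure P]

/-- One-sided deviation inequality for a finite class of functions with values in `[0, c]`. -/
theorem measure_exists_deviation_le {K : Type*} [Finite K] [Nonempty K] {n : ℕ} (hn : 0 < n)
    {g : K → Ω → ℝ} (hg : ∀ k, Measurable (g k)) {c : ℝ} (hc : 0 < c)
    (h0 : ∀ k x, 0 ≤ g k x) (h1 : ∀ k x, g k x ≤ c) {R σ : ℝ} (hσ : 0 ≤ σ)
    (hR : ∀ x : Fin n ⊕ Fin n → Ω, ∑ s : Fin n ⊕ Fin n → Bool,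
      ⨆ k, ∑ i, label (s i) * g k (x i) ≤ Fintype.card (Fin n ⊕ Fin n → Bool) * R) :
    (Measure.pi fun _ : Fin n => P) {z | ∃ k, R / (1 - 1 / (2 * √(2 * n))) / n + c * σ ≤
      ∫ y, g k y ∂P - (1 / (n : ℝ)) * ∑ i, g k (z i)} ≤
      ENNReal.ofReal (Real.exp (-(2 * n * σ ^ 2))) := by
  have hn0 : (0 : ℝ) < n := by exact_mod_cast hn
  have hθ := symmetrization_factor_pos hn
  have hC : ∀ k x, |g k x| ≤ c := fun k x => by rw [abs_of_nonneg (h0 k x)]; exact h1 k x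
  have hE := integral_iSup_sub_le (P := P) hn hg hC hR
  let f : (Fin n → Ω) → ℝ := fun z => ⨆ k, (n * ∫ y, g k y ∂P - ∑ i, g k (z i))
  have hf : Measurable f := by
    simpa [f, sub_eq_add_neg] using measurable_max hg (fun _ : Fin n => -1)
      (fun k => n * ∫ y, g k y ∂P)
  have hfC : ∃ C, ∀ z, |f z| ≤ C := ⟨_, fun z => by
    simpa [f, sub_eq_add_neg] using abs_max_le (P := P) hC (fun _ : Fin n => -1) n z⟩
  have hfc : ∀ z i x, f (Function.update z i x) - f z ≤ c := fun z i x => by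
    rw [sub_le_iff_le_add]
    refine ciSup_le fun k => ?_
    have h2 := le_iSup_of_finite (fun k => n * ∫ y, g k y ∂P - ∑ i, g k (z i)) k
    have h3 : ∑ j, g k (z j) ≤ ∑ j, g k (Function.update z i x j) + c := by
      rw [← Finset.add_sum_erase _ _ (Finset.mem_univ i),
        ← Finset.add_sum_erase _ (fun j => g k (Function.update z i x j)) (Finset.mem_univ i)]
      have : ∑ j ∈ Finset.univ.erase i, g k (Function.update z i x j) =
          ∑ j ∈ Finset.univ.erase i, g k (z j) := Finset.sum_congr rfl fun j hj => by
        rw [Function.update_of_ne (Finset.ne_of_mem_erase hj)]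
      rw [this]
      linarith [h1 k (z i), h0 k (Function.update z i x i)]
    simp only [f]
    linarith
  have hM := measure_ge_le_of_boundedDifferences P hc hn hf hfC hfc
    (ε := n * (c * σ)) (by positivity)
  rw [show 2 * (n * (c * σ)) ^ 2 / (n * c ^ 2) = 2 * n * σ ^ 2 by field_simp] at hM
  refine le_trans (measure_mono ?_)
    ((ENNReal.le_ofReal_iff_toReal_le (measure_ne_top _ _) (Real.exp_pos _).le).2 hM)
  rintro z ⟨k, hk⟩
  have h2 := le_iSup_of_finite (fun k => n * ∫ y, g k y ∂P - ∑ i, g k (z i)) k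
  have h3 : ∫ z, f z ∂(Measure.pi fun _ => P) ≤ R / (1 - 1 / (2 * √(2 * n))) := by
    rw [le_div_iff₀ hθ, mul_comm]
    exact hE
  have h4 := mul_le_mul_of_nonneg_left hk hn0.le
  have h5 : (n : ℝ) * (R / (1 - 1 / (2 * √(2 * n))) / n + c * σ) =
      R / (1 - 1 / (2 * √(2 * n))) + n * (c * σ) := by field_simp
  have h6 : (n : ℝ) * (∫ y, g k y ∂P - (1 / (n : ℝ)) * ∑ i, g k (z i)) =
      n * ∫ y, g k y ∂P - ∑ i, g k (z i) := by field_simp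
  rw [h5, h6] at h4
  change ∫ y, f y ∂(Measure.pi fun _ => P) + n * (c * σ) ≤ f z
  simp only [f] at h3 ⊢
  linarith

/-- The deviation inequality for a sequence of functions. -/
theorem measure_exists_nat_deviation_le {n : ℕ} (hn : 0 < n) {g : ℕ → Ω → ℝ}
    (hg : ∀ k, Measurable (g k)) {c : ℝ} (hc : 0 < c) (h0 : ∀ k x, 0 ≤ g k x)
    (h1 : ∀ k x, g k x ≤ c) {R σ : ℝ} (hσ : 0 ≤ σ)
    (hR : ∀ m : ℕ, ∀ x : Fin n ⊕ Fin n → Ω, ∑ s : Fin n ⊕ Fin n → Bool,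
      ⨆ k : Fin (m + 1), ∑ i, label (s i) * g k (x i) ≤
        Fintype.card (Fin n ⊕ Fin n → Bool) * R) :
    (Measure.pi fun _ : Fin n => P) {z | ∃ k, R / (1 - 1 / (2 * √(2 * n))) / n + c * σ ≤
      ∫ y, g k y ∂P - (1 / (n : ℝ)) * ∑ i, g k (z i)} ≤
      ENNReal.ofReal (Real.exp (-(2 * n * σ ^ 2))) := by
  let S : ℕ → Set (Fin n → Ω) := fun m => {z | ∃ k : Fin (m + 1),
    R / (1 - 1 / (2 * √(2 * n))) / n + c * σ ≤ ∫ y, g k y ∂P - (1 / (n : ℝ)) * ∑ i, g k (z i)}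
  have hS : Monotone S := by
    rintro m m' hm z ⟨k, hk⟩
    exact ⟨⟨k, by omega⟩, hk⟩
  have hU : {z : Fin n → Ω | ∃ k, R / (1 - 1 / (2 * √(2 * n))) / n + c * σ ≤
      ∫ y, g k y ∂P - (1 / (n : ℝ)) * ∑ i, g k (z i)} = ⋃ m, S m := by
    ext z
    rw [Set.mem_iUnion]
    constructor
    · rintro ⟨k, hk⟩
      exact ⟨k, ⟨k, by omega⟩, hk⟩
    · rintro ⟨m, k, hk⟩
      exact ⟨k, hk⟩
  rw [hU, hS.measure_iUnion]
  exact iSup_le fun m => measure_exists_deviation_le hn (fun k : Fin (m + 1) => hg k) hc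
    (fun k => h0 k) (fun k => h1 k) hσ (hR m)

end Deviation

section Violation

variable {X : Type*} {T : ℕ}

/-- The amount by which `|hbar(x)ᵀ ν|` exceeds the margin `t`. -/
noncomputable def excess (hbar : Fin T → X → ℝ) (ν : Fin T → ℝ) (t : ℝ) (x : X) : ℝ :=
  max (|comb hbar ν x| - t) 0

theorem excess_nonneg (hbar : Fin T → X → ℝ) (ν : Fin T → ℝ) (t : ℝ) (x : X) :
    0 ≤ excess hbar ν t x := le_max_right _ _

theorem abs_comb_le {hbar : Fin T → X → ℝ} (hbound : ∀ j x, -1 ≤ hbar j x ∧ hbar j x ≤ 1)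
    (ν : Fin T → ℝ) (x : X) : |comb hbar ν x| ≤ norm1 ν := by
  refine (Finset.abs_sum_le_sum_abs _ _).trans (Finset.sum_le_sum fun j _ => ?_)
  rw [abs_mul]
  exact mul_le_of_le_one_left (abs_nonneg _) (abs_le.2 (hbound j x))

theorem excess_le {hbar : Fin T → X → ℝ} (hbound : ∀ j x, -1 ≤ hbar j x ∧ hbar j x ≤ 1)
    {ν : Fin T → ℝ} (hν : norm1 ν ≤ 1) {t : ℝ} (ht : t ≤ 1) (x : X) :
    excess hbar ν t x ≤ 1 - t :=
  max_le (by linarith [abs_comb_le hbound ν x]) (by linarith)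

theorem measurable_comb [MeasurableSpace X] {hbar : Fin T → X → ℝ}
    (hmeas : ∀ j, Measurable (hbar j)) (ν : Fin T → ℝ) : Measurable (comb hbar ν) :=
  Finset.measurable_sum _ fun j _ => (hmeas j).mul_const _

theorem measurable_excess [MeasurableSpace X] {hbar : Fin T → X → ℝ}
    (hmeas : ∀ j, Measurable (hbar j)) (ν : Fin T → ℝ) (t : ℝ) :
    Measurable (excess hbar ν t) := by
  have := measurable_comb hmeas ν
  unfold excess
  fun_prop

theorem continuous_excess (hbar : Fin T → X → ℝ) (t : ℝ) (x : X) :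
    Continuous fun ν => excess hbar ν t x := by
  unfold excess comb
  fun_prop

theorem excess_lipschitz (t a b : ℝ) :
    |max (|a| - t) 0 - max (|b| - t) 0| ≤ |a - b| := by
  refine (abs_max_sub_max_le_abs _ _ _).trans ?_
  rw [sub_sub_sub_cancel_right]
  exact abs_abs_sub_abs_le_abs_sub a b

/-- The average, over the sign vectors of length `2 n`, of the maximal signed sum of the excesses
of coefficients in the unit ball. -/
theorem sum_signs_excess_le {K : Type*} [Finite K] [Nonempty K] {hbar : Fin T → X → ℝ}
    (hbound : ∀ j x, -1 ≤ hbar j x ∧ hbar j x ≤ 1)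
    (hneg : ∀ j, ∃ j', ∀ x, hbar j' x = -hbar j x) {n : ℕ} (hn : 0 < n)
    (hD : 0 < vcDim hbar) (hDn : vcDim hbar ≤ n) {ν : K → Fin T → ℝ} (hν : ∀ k, norm1 (ν k) ≤ 1)
    (t : ℝ) (x : Fin n ⊕ Fin n → X) :
    ∑ s : Fin n ⊕ Fin n → Bool, ⨆ k, ∑ i, label (s i) * excess hbar (ν k) t (x i) ≤
      Fintype.card (Fin n ⊕ Fin n → Bool) *
        (2 * √(n * (vcDim hbar * (1 + Real.log (2 * n / vcDim hbar))))) := by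
  have : Nonempty (Fin n ⊕ Fin n) := ⟨.inl ⟨0, hn⟩⟩
  have hcard : Fintype.card (Fin n ⊕ Fin n) = 2 * n := by simp; ring
  refine (sum_signs_contraction (excess_lipschitz t)
    fun k i => comb hbar (ν k) (x i)).trans ?_
  refine (Finset.sum_le_sum fun s _ => ciSup_le fun k =>
    sum_label_mul_comb_le hneg x s (hν k)).trans ?_
  refine (sum_signs_baseRules_le hbar hbound x hD (by omega)).trans (le_of_eq ?_)
  rw [hcard]
  push_cast
  rw [show (2 : ℝ) * (2 * n) * (vcDim hbar * (1 + Real.log (2 * n / vcDim hbar))) =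
    2 ^ 2 * (n * (vcDim hbar * (1 + Real.log (2 * n / vcDim hbar)))) by ring,
    Real.sqrt_mul (by norm_num), Real.sqrt_sq (by norm_num)]

variable [MeasurableSpace X]

/-- At a fixed margin `t`, all coefficients in the unit ball satisfy the deviation inequality
simultaneously outside of one measurable set of small probability. -/
theorem exists_deviation_set {P : Measure (X × Bool)} [IsProbabilityMeasure P]
    {hbar : Fin T → X → ℝ} (hmeas : ∀ j, Measurable (hbar j))
    (hbound : ∀ j x, -1 ≤ hbar j x ∧ hbar j x ≤ 1)
    (hneg : ∀ j, ∃ j', ∀ x, hbar j' x = -hbar j x) {n : ℕ} (hn : 0 < n)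
    (hD : 0 < vcDim hbar) (hDn : vcDim hbar ≤ n) {t : ℝ} (ht1 : t < 1) {σ : ℝ} (hσ : 0 ≤ σ) :
    ∃ B : Set (Fin n → X × Bool), MeasurableSet B ∧
      (Measure.pi fun _ => P) B ≤ ENNReal.ofReal (Real.exp (-(2 * n * σ ^ 2))) ∧
      ∀ z ∉ B, ∀ ν : Fin T → ℝ, norm1 ν ≤ 1 →
        ∫ q, excess hbar ν t q.1 ∂P - (1 / (n : ℝ)) * ∑ i, excess hbar ν t (z i).1 ≤
          2 * √(n * (vcDim hbar * (1 + Real.log (2 * n / vcDim hbar)))) /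
            (1 - 1 / (2 * √(2 * n))) / n + (1 - t) * σ := by
  set E := 2 * √(n * (vcDim hbar * (1 + Real.log (2 * n / vcDim hbar)))) /
            (1 - 1 / (2 * √(2 * n))) / n + (1 - t) * σ with hE
  let ball : Set (Fin T → ℝ) := {ν | norm1 ν ≤ 1}
  have hne : Nonempty ball := ⟨0, by simp [ball, norm1]⟩
  let ν : ℕ → Fin T → ℝ := fun k => TopologicalSpace.denseSeq ball k
  have hν : ∀ k, norm1 (ν k) ≤ 1 := fun k => (TopologicalSpace.denseSeq ball k).2
  have hg : ∀ k, Measurable fun q : X × Bool => excess hbar (ν k) t q.1 := fun k =>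
    (measurable_excess hmeas _ t).comp measurable_fst
  refine ⟨{z | ∃ k, E ≤ ∫ q, excess hbar (ν k) t q.1 ∂P -
    (1 / (n : ℝ)) * ∑ i, excess hbar (ν k) t (z i).1}, ?_, ?_, ?_⟩
  · rw [Set.ofPred_exists]
    refine MeasurableSet.iUnion fun k => measurableSet_le measurable_const ?_
    refine measurable_const.sub (Measurable.const_mul ?_ _)
    exact Finset.measurable_sum _ fun i _ => (hg k).comp (measurable_pi_apply i)
  · exact measure_exists_nat_deviation_le hn hg (sub_pos.2 ht1) (fun k q => excess_nonneg _ _ _ _)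
      (fun k q => excess_le hbound (hν k) ht1.le _) hσ fun m x =>
        sum_signs_excess_le hbound hneg hn hD hDn (fun k : Fin (m + 1) => hν k) t
          fun i => (x i).1
  · intro z hz
    have hcont : Continuous fun ν : ball => ∫ q, excess hbar ν t q.1 ∂P -
        (1 / (n : ℝ)) * ∑ i, excess hbar ν t (z i).1 := by
      refine Continuous.sub ?_ (Continuous.mul continuous_const ?_)
      · refine continuous_of_dominated (bound := fun _ => 1 - t) (fun ν => ?_) (fun ν => ?_)
          (integrable_const _) ?_
        · exact ((measurable_excess hmeas _ t).comp measurable_fst).aestronglyMeasurable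
        · refine Filter.Eventually.of_forall fun q => ?_
          rw [Real.norm_eq_abs, abs_of_nonneg (excess_nonneg _ _ _ _)]
          exact excess_le hbound ν.2 ht1.le _
        · exact Filter.Eventually.of_forall fun q =>
            (continuous_excess hbar t q.1).comp continuous_subtype_val
      · exact continuous_finsetSum _ fun i _ =>
          (continuous_excess hbar t _).comp continuous_subtype_val
    have hcl : IsClosed {ν : ball | ∫ q, excess hbar ν t q.1 ∂P -
        (1 / (n : ℝ)) * ∑ i, excess hbar ν t (z i).1 ≤ E} := isClosed_le hcont continuous_const
    have hsub : Set.range (TopologicalSpace.denseSeq ball) ⊆ {ν : ball |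
        ∫ q, excess hbar ν t q.1 ∂P - (1 / (n : ℝ)) * ∑ i, excess hbar ν t (z i).1 ≤ E} := by
      rintro _ ⟨k, rfl⟩
      by_contra hk
      exact hz ⟨k, (not_le.1 hk).le⟩
    intro ν hν
    exact (hcl.closure_subset_iff.2 hsub)
      ((TopologicalSpace.denseRange_denseSeq ball) ⟨ν, hν⟩)

end Violation

section TrainDist

variable {X : Type*} [MeasurableSpace X] (pstar : Measure (X × Bool)) {rho : Bool → X → ℝ}

/-- Flipping labels does not change the marginal on the instances. -/
theorem map_fst_trainDist (hrho_meas : ∀ y, Measurable (rho y))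
    (hrho : ∀ y x, 0 ≤ rho y x ∧ rho y x ≤ 1) :
    (trainDist pstar rho).map Prod.fst = pstar.map Prod.fst := by
  have hr : Measurable fun q : X × Bool => rho q.2 q.1 :=
    measurable_from_prod_countable_left hrho_meas
  have hflip : Measurable fun q : X × Bool => (q.1, !q.2) :=
    measurable_fst.prodMk ((measurable_of_finite not).comp measurable_snd)
  ext A hA
  have hA' : MeasurableSet (Prod.fst ⁻¹' A : Set (X × Bool)) := measurable_fst hA
  rw [Measure.map_apply measurable_fst hA, Measure.map_apply measurable_fst hA, trainDist,
    Measure.add_apply, Measure.map_apply hflip hA',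
    show (fun q : X × Bool => (q.1, !q.2)) ⁻¹' (Prod.fst ⁻¹' A) = Prod.fst ⁻¹' A from rfl,
    withDensity_apply _ hA', withDensity_apply _ hA', ← lintegral_add_left (hr.const_sub 1).ennreal_ofReal]
  have : ∀ q : X × Bool, ENNReal.ofReal (1 - rho q.2 q.1) + ENNReal.ofReal (rho q.2 q.1) = 1 :=
    fun q => by
      rw [← ENNReal.ofReal_add (by linarith [(hrho q.2 q.1).2]) (hrho q.2 q.1).1]
      simp
  simp [this]

theorem isProbabilityMeasure_trainDist [IsProbabilityMeasure pstar]
    (hrho_meas : ∀ y, Measurable (rho y)) (hrho : ∀ y x, 0 ≤ rho y x ∧ rho y x ≤ 1) :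
    IsProbabilityMeasure (trainDist pstar rho) := by
  refine ⟨?_⟩
  rw [← Set.preimage_univ (f := Prod.fst), ← Measure.map_apply measurable_fst MeasurableSet.univ,
    map_fst_trainDist pstar hrho_meas hrho, Measure.map_apply measurable_fst MeasurableSet.univ,
    Set.preimage_univ, measure_univ]

end TrainDist

/-! ### The constants -/

section Constants

/-- For `L = log (3 u)` the second hypothesis says `8 log (3 u) < u`. If `L ≤ 4.7`, the exponential
is below its chord on `[1, 4.7]`, and the chord is below `24 L`. -/
theorem lt_log_of_lt {L : ℝ} (hL : 1 ≤ L) (h : 24 * L < Real.exp L) : 4.7 < L := by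
  by_contra! hc
  have he1 : Real.exp 1 ≤ 24 := by linarith [Real.exp_one_lt_d9]
  have he2 : Real.exp 4.7 ≤ 112 := by
    have h1 : Real.exp 4.7 ^ 10 = Real.exp 1 ^ 47 := by
      rw [← Real.exp_nat_mul, ← Real.exp_nat_mul]
      norm_num
    refine le_of_pow_le_pow_left₀ (n := 10) (by norm_num) (by norm_num) ?_
    rw [h1]
    calc Real.exp 1 ^ 47 ≤ 2.7182818286 ^ 47 :=
          pow_le_pow_left₀ (Real.exp_pos 1).le Real.exp_one_lt_d9.le 47
      _ ≤ _ := by norm_num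
  have ha : 0 ≤ (4.7 - L) / 3.7 := div_nonneg (by linarith) (by norm_num)
  have hb : 0 ≤ (L - 1) / 3.7 := div_nonneg (by linarith) (by norm_num)
  have hconv := convexOn_exp.2 (Set.mem_univ (1 : ℝ)) (Set.mem_univ (4.7 : ℝ)) ha hb
    (by rw [← add_div]; norm_num)
  simp only [smul_eq_mul] at hconv
  rw [show (4.7 - L) / 3.7 * 1 + (L - 1) / 3.7 * 4.7 = L by ring] at hconv
  have h1 : (4.7 - L) / 3.7 * Real.exp 1 ≤ (4.7 - L) / 3.7 * 24 :=
    mul_le_mul_of_nonneg_left he1 ha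
  have h2 : (L - 1) / 3.7 * Real.exp 4.7 ≤ (L - 1) / 3.7 * 112 :=
    mul_le_mul_of_nonneg_left he2 hb
  have h3 : (4.7 - L) / 3.7 * 24 + (L - 1) / 3.7 * 112 ≤ 24 * L := by
    have : (4.7 - L) / 3.7 * 24 + (L - 1) / 3.7 * 112 = (88 * L + 0.8) / 3.7 := by ring
    rw [this, div_le_iff₀ (by norm_num)]
    linarith
  linarith

variable {n D : ℕ}

/-- The only relevant case is `2 R < 1` for `R = √(2 D log (3 n / D) / n)`, and then `n / D` is
large. -/
theorem log_gt_of_two_mul_sqrt_lt_one (hD : 0 < D) (hDn : D ≤ n)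
    (hq : 2 * √(2 * D * Real.log (3 * n / D) / n) < 1) :
    4.7 < Real.log (3 * n / D) ∧ 8 * D * Real.log (3 * n / D) < n := by
  set L := Real.log (3 * n / D) with hL
  have hD0 : (0 : ℝ) < D := by exact_mod_cast hD
  have hn0 : (0 : ℝ) < n := by exact_mod_cast hD.trans_le hDn
  have hDn' : (D : ℝ) ≤ n := by exact_mod_cast hDn
  have h3 : (3 : ℝ) ≤ 3 * n / D := by
    rw [le_div_iff₀ hD0]; linarith
  have hL1 : 1 ≤ L := by
    rw [hL, Real.le_log_iff_exp_le (by positivity)]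
    linarith [Real.exp_one_lt_d9]
  have h1 : 8 * D * L < n := by
    have h : √(2 * D * L / n) < 1 / 2 := by linarith
    rw [Real.sqrt_lt' (by norm_num), div_lt_iff₀ hn0] at h
    linarith
  refine ⟨lt_log_of_lt hL1 ?_, h1⟩
  rw [hL, Real.exp_log (by positivity), ← hL, lt_div_iff₀ hD0]
  linarith

/-- The symmetrization bound with `2 n` signs beats `2 R` by `20.3` per cent. -/
theorem symmetrization_bound_le (hD : 0 < D) (hDn : D ≤ n)
    (hq : 2 * √(2 * D * Real.log (3 * n / D) / n) < 1) :
    2 * √(n * (D * (1 + Real.log (2 * n / D)))) / (1 - 1 / (2 * √(2 * n))) / n ≤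
      0.797 * (2 * √(2 * D * Real.log (3 * n / D) / n)) := by
  obtain ⟨hL, hn⟩ := log_gt_of_two_mul_sqrt_lt_one hD hDn hq
  set L := Real.log (3 * n / D) with hLdef
  have hD0 : (0 : ℝ) < D := by exact_mod_cast hD
  have hD1 : (1 : ℝ) ≤ D := by exact_mod_cast hD
  have hn0 : (0 : ℝ) < n := by exact_mod_cast hD.trans_le hDn
  have hn37 : (37.6 : ℝ) < n := by nlinarith
  have hθ : (0.9423 : ℝ) ≤ 1 - 1 / (2 * √(2 * n)) := by
    have h1 : (8.671 : ℝ) ≤ √(2 * n) := by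
      rw [Real.le_sqrt (by norm_num) (by positivity)]
      norm_num
      linarith
    have h2 : 1 / (2 * √(2 * n)) ≤ 1 / (2 * 8.671) := by gcongr
    norm_num at h2 ⊢
    linarith
  have hlog : 1 + Real.log (2 * n / D) ≤ 1.1279 * L := by
    have h2 : Real.log (2 * n / D) = Real.log 2 + Real.log (n / D) := by
      rw [mul_div_assoc, Real.log_mul (by norm_num) (by positivity)]
    have h3 : L = Real.log 3 + Real.log (n / D) := by
      rw [hLdef, mul_div_assoc, Real.log_mul (by norm_num) (by positivity)]
    linarith [Real.log_two_lt_d9, Real.log_three_gt_d9]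
  rw [div_div, div_le_iff₀ (by nlinarith)]
  have hkey : √(n * (D * (1 + Real.log (2 * n / D)))) ≤
      0.797 * 0.9423 * n * √(2 * D * L / n) := by
    refine Real.sqrt_le_iff.2 ⟨by positivity, ?_⟩
    rw [mul_pow, Real.sq_sqrt (by positivity)]
    have : (0.797 * 0.9423 * (n : ℝ)) ^ 2 * (2 * D * L / n) =
        n * (D * (2 * (0.797 * 0.9423) ^ 2 * L)) := by
      field_simp
    rw [this]
    gcongr
    refine hlog.trans ?_
    norm_num
    nlinarith
  calc 2 * √(n * (D * (1 + Real.log (2 * n / D))))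
      ≤ 2 * (0.797 * 0.9423 * n * √(2 * D * L / n)) := by gcongr
    _ = 0.797 * (2 * √(2 * D * L / n)) * (0.9423 * n) := by ring
    _ ≤ _ := by gcongr

/-- The failure probabilities at the margins `1 - 1 / b` for `b = 1 + j κ / 8`. -/
theorem exp_deviation_le (hD : 0 < D) (hDn : D ≤ n)
    (hq : 2 * √(2 * D * Real.log (3 * n / D) / n) < 1) {δ s κ b : ℝ} (hs0 : 0 ≤ s)
    (hs : Real.exp (-(2 * n * s ^ 2)) = δ)
    (hκ : κ = 0.203 * (2 * √(2 * D * Real.log (3 * n / D) / n))) (j : ℕ)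
    (hb : b = 1 + j * (κ / 8)) :
    Real.exp (-(2 * n * (s + 7 / 8 * κ * b) ^ 2)) ≤
      δ * (Real.exp (-(Real.log (3 * n / D) / 2)) *
        Real.exp (-(Real.log (3 * n / D) * κ / 8)) ^ j) := by
  obtain ⟨hL, hn⟩ := log_gt_of_two_mul_sqrt_lt_one hD hDn hq
  set L := Real.log (3 * n / D) with hLdef
  have hD1 : (1 : ℝ) ≤ D := by exact_mod_cast hD
  have hn0 : (0 : ℝ) < n := by exact_mod_cast hD.trans_le hDn
  have hκ0 : 0 ≤ κ := by rw [hκ]; positivity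
  have hκ2 : n * κ ^ 2 = 0.203 ^ 2 * 8 * D * L := by
    rw [hκ, mul_pow, mul_pow, Real.sq_sqrt (by positivity)]
    field_simp
    norm_num
  have hA : L / 2 ≤ 49 / 32 * (n * κ ^ 2) := by
    rw [hκ2]
    nlinarith
  have hb2 : 1 + j * (κ / 4) ≤ b ^ 2 := by
    rw [hb]
    nlinarith [sq_nonneg ((j : ℝ) * (κ / 8))]
  have hb0 : 0 ≤ b := by rw [hb]; positivity
  rw [← hs, ← Real.exp_nat_mul, ← Real.exp_add, ← Real.exp_add, Real.exp_le_exp]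
  have h1 : s ^ 2 + (7 / 8 * κ * b) ^ 2 ≤ (s + 7 / 8 * κ * b) ^ 2 := by
    have : 0 ≤ s * (7 / 8 * κ * b) := by positivity
    nlinarith
  have h2 : L / 2 + j * (L * κ / 8) ≤ 2 * n * (7 / 8 * κ * b) ^ 2 := by
    calc L / 2 + j * (L * κ / 8) = L / 2 * (1 + j * (κ / 4)) := by ring
      _ ≤ 49 / 32 * (n * κ ^ 2) * b ^ 2 := by gcongr
      _ = _ := by ring
  have h3 := mul_le_mul_of_nonneg_left h1 (by positivity : (0 : ℝ) ≤ 2 * n)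
  linarith

/-- The geometric series of the failure probabilities. -/
theorem exp_le_one_sub_exp (hD : 0 < D) (hDn : D ≤ n)
    (hq : 2 * √(2 * D * Real.log (3 * n / D) / n) < 1) {κ : ℝ}
    (hκ : κ = 0.203 * (2 * √(2 * D * Real.log (3 * n / D) / n))) :
    Real.exp (-(Real.log (3 * n / D) / 2)) ≤
      1 - Real.exp (-(Real.log (3 * n / D) * κ / 8)) := by
  obtain ⟨hL, hn⟩ := log_gt_of_two_mul_sqrt_lt_one hD hDn hq
  set L := Real.log (3 * n / D) with hLdef
  have hD0 : (0 : ℝ) < D := by exact_mod_cast hD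
  have hn0 : (0 : ℝ) < n := by exact_mod_cast hD.trans_le hDn
  set x := Real.exp (-(L / 2)) with hx
  have hx0 : 0 < x := Real.exp_pos _
  have hx1 : x ≤ 0.1 := by
    have h1 : (10 : ℝ) ≤ Real.exp (L / 2) := by
      have h2 : Real.exp 2.35 ≤ Real.exp (L / 2) := Real.exp_le_exp.2 (by linarith)
      have h3 : (10 : ℝ) ≤ Real.exp 2.35 := by
        refine le_of_pow_le_pow_left₀ (n := 20) (by norm_num) (Real.exp_pos _).le ?_
        have h4 : Real.exp 2.35 ^ 20 = Real.exp 1 ^ 47 := by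
          rw [← Real.exp_nat_mul, ← Real.exp_nat_mul]
          norm_num
        rw [h4]
        calc (10 : ℝ) ^ 20 ≤ 2.7182818283 ^ 47 := by norm_num
          _ ≤ _ := pow_le_pow_left₀ (by norm_num) Real.exp_one_gt_d9.le 47
      linarith
    rw [hx, Real.exp_neg]
    calc (Real.exp (L / 2))⁻¹ ≤ 10⁻¹ := by gcongr
      _ = _ := by norm_num
  -- `κ` in terms of `x = √(D / (3 n))`
  have hx2 : x ^ 2 = D / (3 * n) := by
    rw [hx, ← Real.exp_nat_mul, show ((2 : ℕ) : ℝ) * -(L / 2) = -L by push_cast; ring,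
      Real.exp_neg, hLdef, Real.exp_log (by positivity), inv_div]
  have hκx : κ = 0.203 * √(24 * L) * x := by
    have h1 : 2 * √(2 * D * L / n) = √(24 * L) * x := by
      rw [← Real.sqrt_sq hx0.le, hx2, ← Real.sqrt_mul (by positivity),
        show (2 : ℝ) = √(2 ^ 2) by rw [Real.sqrt_sq (by norm_num)],
        ← Real.sqrt_mul (by positivity), Real.sqrt_sq (by norm_num)]
      congr 1
      field_simp
      norm_num
    rw [hκ, h1]
    ring
  have hsq : (10.6 : ℝ) ≤ √(24 * L) := by
    rw [Real.le_sqrt (by norm_num) (by positivity)]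
    norm_num
    linarith
  set w := L * κ / 8 with hw
  have hw1 : x ≤ w * 0.9 := by
    have h1 : (4.7 : ℝ) * 10.6 ≤ L * √(24 * L) := by gcongr
    have h2 : w * 0.9 = 0.203 / 8 * 0.9 * (L * √(24 * L)) * x := by
      rw [hw, hκx]; ring
    rw [h2]
    norm_num at h1 ⊢
    nlinarith
  have hw0 : 0 < w := by linarith
  have h1 : Real.exp (-w) ≤ 1 / (1 + w) := by
    rw [Real.exp_neg, ← one_div]
    exact one_div_le_one_div_of_le (by linarith) (by linarith [Real.add_one_le_exp w])
  have h2 : x * (1 + w) ≤ w := by nlinarith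
  have h3 : 1 / (1 + w) = 1 - w / (1 + w) := by field_simp; ring
  have h4 : x ≤ w / (1 + w) := by rwa [le_div_iff₀ (by linarith)]
  linarith

end Constants

/-! ### Uniform control of the constraint violation -/

section UniformViolation

variable {X : Type*} {T : ℕ}

theorem comb_smul (hbar : Fin T → X → ℝ) (r : ℝ) (μ : Fin T → ℝ) (x : X) :
    comb hbar (r • μ) x = r * comb hbar μ x := by
  simp only [comb, Pi.smul_apply, smul_eq_mul, Finset.mul_sum]
  exact Finset.sum_congr rfl fun j _ => by ring

theorem norm1_smul (r : ℝ) (μ : Fin T → ℝ) : norm1 (r • μ) = |r| * norm1 μ := by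
  simp [norm1, abs_mul, Finset.mul_sum]

theorem excess_smul (hbar : Fin T → X → ℝ) {r : ℝ} (hr : 0 ≤ r) (μ : Fin T → ℝ) (t : ℝ) (x : X) :
    excess hbar (r • μ) (r * t) x = r * excess hbar μ t x := by
  rw [excess, excess, comb_smul, abs_mul, abs_of_nonneg hr, mul_max_of_nonneg _ _ hr, mul_sub,
    mul_zero]

/-- Symmetric base-rules of VC-dimension zero vanish. -/
theorem baseRules_eq_zero {hbar : Fin T → X → ℝ} (hneg : ∀ j, ∃ j', ∀ x, hbar j' x = -hbar j x)
    (hD : vcDim hbar = 0) (j : Fin T) (x : X) : hbar j x = 0 := by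
  by_contra hne
  obtain ⟨j', hj'⟩ := hneg j
  have hpos : ∃ p, 0 < hbar p x := by
    rcases lt_or_gt_of_ne hne with h | h
    · exact ⟨j', by rw [hj']; linarith⟩
    · exact ⟨j, h⟩
  obtain ⟨p, hp⟩ := hpos
  obtain ⟨m, hm⟩ := hneg p
  have h1 : 1 ≤ vcDim hbar := by
    refine le_csSup (bddAbove_vcDim hbar) ⟨{x}, Finset.card_singleton x, fun _ => 0, fun A hA => ?_⟩
    rcases Finset.subset_singleton_iff.1 hA with rfl | rfl
    · exact ⟨m, fun y hy => by
        rw [Finset.mem_singleton.1 hy, hm]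
        simp [hp.le]⟩
    · exact ⟨p, fun y hy => by
        rw [Finset.mem_singleton.1 hy]
        simp [hp]⟩
  omega

/-- Transfer of a deviation bound from the margin `1 - 1 / b'` to a larger margin `1 - 1 / b`, for
coefficients that satisfy the constraints with the larger margin on all samples: the excess over
`1 - 1 / b` is at most `b' / b` times the excess over `1 - 1 / b'`. -/
theorem integral_excess_le_of_margin [MeasurableSpace X] {P : Measure (X × Bool)}
    [IsProbabilityMeasure P] {hbar : Fin T → X → ℝ} (hmeas : ∀ j, Measurable (hbar j))
    (hbound : ∀ j x, -1 ≤ hbar j x ∧ hbar j x ≤ 1) {n : ℕ} (hn : 0 < n) {ν : Fin T → ℝ}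
    (hν : norm1 ν ≤ 1) {b b' : ℝ} (hb' : 1 ≤ b') (hbb : b' ≤ b) {z : Fin n → X × Bool}
    (hz : ∀ i, |comb hbar ν (z i).1| ≤ 1 - 1 / b) {e : ℝ}
    (he : ∫ q, excess hbar ν (1 - 1 / b') q.1 ∂P -
      (1 / (n : ℝ)) * ∑ i, excess hbar ν (1 - 1 / b') (z i).1 ≤ e) :
    ∫ q, excess hbar ν (1 - 1 / b) q.1 ∂P ≤ b' / b * (e + (1 / b' - 1 / b)) := by
  have hb'0 : 0 < b' := by linarith
  have hb0 : 0 < b := by linarith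
  have hn0 : (0 : ℝ) < n := by exact_mod_cast hn
  have hdiff : 0 ≤ 1 / b' - 1 / b := sub_nonneg.2 (one_div_le_one_div_of_le hb'0 hbb)
  have hemp : (1 / (n : ℝ)) * ∑ i, excess hbar ν (1 - 1 / b') (z i).1 ≤ 1 / b' - 1 / b := by
    have : ∑ i, excess hbar ν (1 - 1 / b') (z i).1 ≤ ∑ _i : Fin n, (1 / b' - 1 / b) :=
      Finset.sum_le_sum fun i _ => max_le (by linarith [hz i]) hdiff
    rw [Finset.sum_const, Finset.card_univ, Fintype.card_fin, nsmul_eq_mul] at this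
    rwa [one_div, inv_mul_le_iff₀ hn0]
  have hint : ∀ t : ℝ, 0 ≤ t → t ≤ 1 →
      Integrable (fun q : X × Bool => excess hbar ν t q.1) P := fun t ht0 ht1 =>
    integrable_of_abs_le ((measurable_excess hmeas ν t).comp measurable_fst) (C := 1) fun q => by
      rw [abs_of_nonneg (excess_nonneg _ _ _ _)]
      linarith [excess_le hbound hν ht1 q.1]
  have hmargin : ∀ c : ℝ, 1 ≤ c → 0 ≤ 1 - 1 / c ∧ 1 - 1 / c ≤ 1 := fun c hc => by
    have h1 : 1 / c ≤ 1 := by rw [div_le_one (by linarith)]; exact hc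
    have h2 : 0 ≤ 1 / c := by positivity
    constructor <;> linarith
  have hpt : ∀ x, excess hbar ν (1 - 1 / b) x ≤ b' / b * excess hbar ν (1 - 1 / b') x := by
    intro x
    have ha := (abs_comb_le hbound ν x).trans hν
    have hr1 : b' / b ≤ 1 := (div_le_one hb0).2 hbb
    refine max_le ?_ (mul_nonneg (by positivity) (excess_nonneg _ _ _ _))
    refine le_trans ?_ (mul_le_mul_of_nonneg_left (le_max_left _ _) (by positivity))
    have h1 : b' / b * (1 / b') = 1 / b := by field_simp
    calc |comb hbar ν x| - (1 - 1 / b) = 1 / b - (1 - |comb hbar ν x|) := by ring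
      _ ≤ 1 / b - b' / b * (1 - |comb hbar ν x|) := by
          have := mul_le_of_le_one_left (sub_nonneg.2 ha) hr1
          linarith
      _ = b' / b * (|comb hbar ν x| - (1 - 1 / b')) := by rw [← h1]; ring
  calc _ ≤ ∫ q, b' / b * excess hbar ν (1 - 1 / b') q.1 ∂P :=
        integral_mono (hint _ (hmargin b (hb'.trans hbb)).1 (hmargin b (hb'.trans hbb)).2)
          ((hint _ (hmargin b' hb').1 (hmargin b' hb').2).const_mul _) fun q => hpt q.1
    _ = b' / b * ∫ q, excess hbar ν (1 - 1 / b') q.1 ∂P := integral_const_mul _ _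
    _ ≤ _ := by
        refine mul_le_mul_of_nonneg_left ?_ (by positivity)
        linarith

variable [MeasurableSpace X]

/-- The main case: outside of an event of probability at most `δ`, the expected excess over the
margin `1 - 1 / b` is at most `2 R + s / b`, simultaneously for all coefficients in the unit ball
and all `b ≥ 1`. The deviation inequality is applied at the margins with
`b = 1, 1 + κ / 8, 1 + 2 κ / 8, …`, where `κ` is the gain of the symmetrization bound over `2 R`. -/
theorem exists_uniform_margin_set {P : Measure (X × Bool)} [IsProbabilityMeasure P]
    {hbar : Fin T → X → ℝ} (hmeas : ∀ j, Measurable (hbar j))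
    (hbound : ∀ j x, -1 ≤ hbar j x ∧ hbar j x ≤ 1)
    (hneg : ∀ j, ∃ j', ∀ x, hbar j' x = -hbar j x) {n : ℕ} (hn : 0 < n)
    (hD : 0 < vcDim hbar) (hDn : vcDim hbar ≤ n)
    (hq : 2 * √(2 * vcDim hbar * Real.log (3 * n / vcDim hbar) / n) < 1)
    {δ : ℝ} (hδ0 : 0 < δ) (hδ1 : δ < 1) :
    ∃ G : Set (Fin n → X × Bool), MeasurableSet G ∧
      ENNReal.ofReal (1 - δ) ≤ (Measure.pi fun _ => P) G ∧
      ∀ z ∈ G, ∀ ν : Fin T → ℝ, norm1 ν ≤ 1 → ∀ b : ℝ, 1 ≤ b →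
        (∀ i, |comb hbar ν (z i).1| ≤ 1 - 1 / b) →
        ∫ q, excess hbar ν (1 - 1 / b) q.1 ∂P ≤
          2 * √(2 * vcDim hbar * Real.log (3 * n / vcDim hbar) / n) +
            1 / b * √(Real.log (1 / δ) / (2 * n)) := by
  have hn0 : (0 : ℝ) < n := by exact_mod_cast hn
  obtain ⟨hL, -⟩ := log_gt_of_two_mul_sqrt_lt_one hD hDn hq
  have hsym := symmetrization_bound_le hD hDn hq
  set q : ℝ := 2 * √(2 * vcDim hbar * Real.log (3 * n / vcDim hbar) / n) with hqdef
  set s : ℝ := √(Real.log (1 / δ) / (2 * n)) with hsdef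
  set L : ℝ := Real.log (3 * n / vcDim hbar) with hLdef
  have hD0 : (0 : ℝ) < vcDim hbar := by exact_mod_cast hD
  have hs0 : 0 ≤ s := Real.sqrt_nonneg _
  have hlogδ : 0 ≤ Real.log (1 / δ) :=
    Real.log_nonneg (by rw [le_div_iff₀ hδ0]; linarith)
  have hsδ : Real.exp (-(2 * n * s ^ 2)) = δ := by
    rw [hsdef, Real.sq_sqrt (by positivity), mul_div_cancel₀ _ (by positivity), one_div,
      Real.log_inv, neg_neg, Real.exp_log hδ0]
  have hq0 : 0 < q := by rw [hqdef]; positivity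
  set κ : ℝ := 0.203 * q with hκ
  have hκ0 : 0 < κ := by positivity
  let b : ℕ → ℝ := fun j => 1 + j * (κ / 8)
  have hb1 : ∀ j, 1 ≤ b j := fun j => by
    have : 0 ≤ (j : ℝ) * (κ / 8) := by positivity
    simp only [b]
    linarith
  have hbpos : ∀ j, 0 < b j := fun j => by linarith [hb1 j]
  have hset := fun j => exists_deviation_set (P := P) hmeas hbound hneg hn hD hDn
    (t := 1 - 1 / b j) (by have := one_div_pos.2 (hbpos j); linarith)
    (σ := s + 7 / 8 * κ * b j) (by have := (hbpos j).le; positivity)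
  choose B hBm hBP hB using hset
  have hmeasure : (Measure.pi fun _ => P) (⋃ j, B j) ≤ ENNReal.ofReal δ := by
    have hgeo := exp_le_one_sub_exp hD hDn hq hκ
    set x := Real.exp (-(L / 2))
    set r := Real.exp (-(L * κ / 8)) with hr
    have hr0 : 0 ≤ r := (Real.exp_pos _).le
    have hr1 : r < 1 := by
      rw [hr, Real.exp_lt_one_iff]
      have : 0 < L * κ / 8 := by
        have : 0 < L := by linarith
        positivity
      linarith
    have hx0 : 0 < x := Real.exp_pos _
    have hsum : HasSum (fun j : ℕ => δ * (x * r ^ j)) (δ * (x * (1 - r)⁻¹)) :=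
      ((hasSum_geometric_of_lt_one hr0 hr1).mul_left x).mul_left δ
    calc _ ≤ ∑' j, (Measure.pi fun _ => P) (B j) := measure_iUnion_le _
      _ ≤ ∑' j : ℕ, ENNReal.ofReal (δ * (x * r ^ j)) :=
          ENNReal.tsum_le_tsum fun j => (hBP j).trans (ENNReal.ofReal_le_ofReal
            (exp_deviation_le hD hDn hq hs0 hsδ hκ j rfl))
      _ = ENNReal.ofReal (δ * (x * (1 - r)⁻¹)) := by
          rw [← ENNReal.ofReal_tsum_of_nonneg (fun j => by positivity) hsum.summable,
            hsum.tsum_eq]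
      _ ≤ ENNReal.ofReal δ := by
          refine ENNReal.ofReal_le_ofReal (mul_le_of_le_one_right hδ0.le ?_)
          rw [← div_eq_mul_inv, div_le_one (by linarith)]
          exact hgeo
  refine ⟨(⋃ j, B j)ᶜ, (MeasurableSet.iUnion hBm).compl, ?_, ?_⟩
  · rw [prob_compl_eq_one_sub (MeasurableSet.iUnion hBm), ENNReal.ofReal_sub _ hδ0.le,
      ENNReal.ofReal_one]
    exact tsub_le_tsub_left hmeasure 1
  · intro z hz ν hν c hc hfeas
    have hc0 : 0 < c := by linarith
    -- the largest margin of the sequence below `1 - 1 / c`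
    set j := ⌊(c - 1) / (κ / 8)⌋₊ with hj
    have hj1 : b j ≤ c := by
      have := Nat.floor_le (a := (c - 1) / (κ / 8)) (div_nonneg (by linarith) (by positivity))
      rw [← hj, le_div_iff₀ (by positivity)] at this
      simp only [b]
      linarith
    have hj2 : c ≤ b j + κ / 8 := by
      have := (Nat.lt_floor_add_one ((c - 1) / (κ / 8))).le
      rw [← hj, div_le_iff₀ (by positivity)] at this
      simp only [b]
      linarith
    have hzj : z ∉ B j := fun h => hz (Set.mem_iUnion.2 ⟨j, h⟩)
    refine (integral_excess_le_of_margin hmeas hbound hn hν (hb1 j) hj1 hfeas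
      (hB j z hzj ν hν)).trans ?_
    have hbj := hbpos j
    have hgap : 1 / b j - 1 / c ≤ κ / 8 := by
      have : 1 / b j - 1 / c = (c - b j) / (b j * c) := by field_simp
      rw [this, div_le_iff₀ (by positivity)]
      have : 1 ≤ b j * c := by nlinarith [hb1 j]
      nlinarith
    have hratio : b j / c ≤ 1 := (div_le_one hc0).2 hj1
    set E := 2 * √(n * (vcDim hbar * (1 + Real.log (2 * n / vcDim hbar)))) /
      (1 - 1 / (2 * √(2 * n))) / n
    calc b j / c * (E + (1 - (1 - 1 / b j)) * (s + 7 / 8 * κ * b j) + (1 / b j - 1 / c))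
        = b j / c * (E + 7 / 8 * κ + (1 / b j - 1 / c)) + 1 / c * s := by
          field_simp
          ring
      _ ≤ b j / c * q + 1 / c * s := by
          gcongr
          linarith
      _ ≤ q + 1 / c * s := by
          gcongr
          exact mul_le_of_le_one_left hq0.le hratio

/-- With probability at least `1 - δ`, the expected constraint violation is at most `epsDelta`,
simultaneously for all coefficients that satisfy the constraints on the samples. -/
theorem exists_uniform_violation_set {P : Measure (X × Bool)} [IsProbabilityMeasure P]
    {hbar : Fin T → X → ℝ} (hmeas : ∀ j, Measurable (hbar j))
    (hbound : ∀ j x, -1 ≤ hbar j x ∧ hbar j x ≤ 1)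
    (hneg : ∀ j, ∃ j', ∀ x, hbar j' x = -hbar j x) {n : ℕ} (hn : 0 < n)
    (hDn : vcDim hbar ≤ n) {δ : ℝ} (hδ0 : 0 < δ) (hδ1 : δ < 1) :
    ∃ G : Set (Fin n → X × Bool), MeasurableSet G ∧
      ENNReal.ofReal (1 - δ) ≤ (Measure.pi fun _ => P) G ∧
      ∀ z ∈ G, ∀ μ : Fin T → ℝ, (∀ i, |comb hbar μ (z i).1| ≤ 1 / 2) →
        ∫ q, excess hbar μ (1 / 2) q.1 ∂P ≤ epsDelta n (vcDim hbar) δ (norm1 μ) := by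
  have huniv : ENNReal.ofReal (1 - δ) ≤
      (Measure.pi fun _ : Fin n => P) (Set.univ : Set (Fin n → X × Bool)) := by
    rw [measure_univ, ENNReal.ofReal_le_one]
    linarith
  have hsmall : ∀ μ : Fin T → ℝ, norm1 μ ≤ 1 / 2 →
      ∫ q, excess hbar μ (1 / 2) q.1 ∂P ≤ epsDelta n (vcDim hbar) δ (norm1 μ) := by
    intro μ hμ
    have : ∀ x, excess hbar μ (1 / 2) x = 0 := fun x =>
      max_eq_right (by linarith [abs_comb_le hbound μ x])
    simp only [this, integral_zero, epsDelta, if_pos hμ, le_refl]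
  have hs0 : 0 ≤ √(Real.log (1 / δ) / (2 * n)) := Real.sqrt_nonneg _
  rcases Nat.eq_zero_or_pos (vcDim hbar) with hD | hD
  · -- all base-rules vanish
    refine ⟨Set.univ, MeasurableSet.univ, huniv, fun z _ μ _ => ?_⟩
    have h0 : ∀ x, excess hbar μ (1 / 2) x = 0 := fun x => by
      simp [excess, comb, baseRules_eq_zero hneg hD]
    simp only [h0, integral_zero, epsDelta]
    split_ifs with h
    · exact le_rfl
    · exact add_nonneg (mul_nonneg (by linarith) (Real.sqrt_nonneg _))
        (mul_nonneg (by linarith) hs0)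
  by_cases hq : 2 * √(2 * vcDim hbar * Real.log (3 * n / vcDim hbar) / n) < 1
  · obtain ⟨G, hGm, hGP, hG⟩ := exists_uniform_margin_set (P := P) hmeas hbound hneg hn hD hDn hq
      hδ0 hδ1
    refine ⟨G, hGm, hGP, fun z hz μ hμ => ?_⟩
    by_cases hc : norm1 μ ≤ 1 / 2
    · exact hsmall μ hc
    set c := norm1 μ with hcdef
    have hc' : 1 / 2 < c := not_le.1 hc
    have hc0 : 0 < c := by linarith
    have hden : 0 < 2 * c - 1 := by linarith
    -- normalize to `‖ν‖₁ = 1`; the margin becomes `1 / (2 c) = 1 - 1 / b`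
    set b := 2 * c / (2 * c - 1) with hb
    have hb1 : 1 ≤ b := by
      rw [hb, le_div_iff₀ hden]; linarith
    have hmargin : 1 - 1 / b = c⁻¹ * (1 / 2) := by
      rw [hb]; field_simp; ring
    have h1 := hG z hz (c⁻¹ • μ)
      (by rw [norm1_smul, abs_of_pos (inv_pos.2 hc0), ← hcdef, inv_mul_cancel₀ hc0.ne']) b hb1
      (fun i => by
        rw [comb_smul, abs_mul, abs_of_pos (inv_pos.2 hc0), hmargin]
        exact mul_le_mul_of_nonneg_left (hμ i) (inv_pos.2 hc0).le)
    simp only [hmargin, excess_smul hbar (inv_pos.2 hc0).le, integral_const_mul] at h1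
    rw [inv_mul_le_iff₀ hc0] at h1
    rw [epsDelta, if_neg hc]
    refine h1.trans (le_of_eq ?_)
    have : c * (1 / b) = c - 1 / 2 := by
      rw [hb]; field_simp
    rw [mul_add, ← mul_assoc c (1 / b), this]
    ring
  · -- the bound exceeds the largest possible violation
    refine ⟨Set.univ, MeasurableSet.univ, huniv, fun z _ μ _ => ?_⟩
    by_cases hc : norm1 μ ≤ 1 / 2
    · exact hsmall μ hc
    rw [epsDelta, if_neg hc]
    set c := norm1 μ with hcdef
    have hc' : 1 / 2 < c := not_le.1 hc
    have h1 : ∫ q, excess hbar μ (1 / 2) q.1 ∂P ≤ ∫ _q, c ∂P := by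
      refine integral_mono (integrable_of_abs_le
        ((measurable_excess hmeas μ _).comp measurable_fst) (C := c) fun q => ?_)
        (integrable_const c) fun q => ?_
      · rw [abs_of_nonneg (excess_nonneg _ _ _ _)]
        exact max_le (by linarith [abs_comb_le hbound μ q.1]) (by linarith)
      · exact max_le (by linarith [abs_comb_le hbound μ q.1]) (by linarith)
    rw [integral_const, probReal_univ, one_smul] at h1
    have h2 : 0 ≤ (c - 1 / 2) * √(Real.log (1 / δ) / (2 * n)) := mul_nonneg (by linarith) hs0
    nlinarith [not_lt.1 hq]

end UniformViolation

end RMBoost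

theorem theorem5 {X : Type*} [MeasurableSpace X] {n T : ℕ} (hn : 0 < n)
    (hbar : Fin T → X → ℝ) (hmeas : ∀ j, Measurable (hbar j))
    (hbound : ∀ j x, -1 ≤ hbar j x ∧ hbar j x ≤ 1)
    (hneg : ∀ j, ∃ j', ∀ x, hbar j' x = -hbar j x)
    (lam : ℝ) (hlam : 0 < lam)
    (pstar : Measure (X × Bool)) [IsProbabilityMeasure pstar]
    (rho : Bool → X → ℝ) (hrho_meas : ∀ y, Measurable (rho y))
    (hrho : ∀ y x, 0 ≤ rho y x ∧ rho y x ≤ 1)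
    (hD : RMBoost.vcDim hbar ≤ n)
    (δ : ℝ) (hδ0 : 0 < δ) (hδ1 : δ < 1) (k : ℕ) :
    ∃ G : Set (Fin n → X × Bool), MeasurableSet G ∧
      ENNReal.ofReal (1 - δ) ≤
        Measure.pi (fun _ : Fin n => RMBoost.trainDist pstar rho) G ∧
      ∀ z ∈ G, ∀ s : RMBoost.State n T, RMBoost.Run lam hbar z k s →
        ∀ mup mum : Fin T → ℝ, RMBoost.IsPrimalSolution lam hbar z Finset.univ mup mum →
          RMBoost.IsEpsOptimal lam hbar z pstar s.mu
            (max ((⨆ j, RMBoost.edge hbar z s.alpha s.beta j) - lam) 0 *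
                RMBoost.norm1 (mup - mum) +
              RMBoost.epsDelta n (RMBoost.vcDim hbar) δ (RMBoost.norm1 s.mu)) := by
  have := RMBoost.isProbabilityMeasure_trainDist pstar hrho_meas hrho
  obtain ⟨G, hGm, hGP, hG⟩ := RMBoost.exists_uniform_violation_set
    (P := RMBoost.trainDist pstar rho) hmeas hbound hneg hn hD hδ0 hδ1
  refine ⟨G, hGm, hGP, fun z hz s hs mup mum hsol => ?_⟩
  refine add_le_add (hs.objective_sub_minimaxRisk_le hn hmeas hneg hlam.le hsol) ?_
  rw [← RMBoost.map_fst_trainDist pstar hrho_meas hrho]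
  refine le_trans (le_of_eq ?_) (hG z hz s.mu (hs.invariant hlam.le).1)
  exact integral_map measurable_fst.aemeasurable
    (RMBoost.measurable_excess hmeas s.mu (1 / 2)).aestronglyMeasurable
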